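/- Let $n\ge 0$ and let $U$ be a unitary $2^n\times 2^n$ complex matrix, viewed as an operator on $n$ qubits with rows and columns labelled by the computational basis $\{0,1\}^n$. Let $\mathbb{Z}[\frac{1}{\sqrt2},i]$ be the subring of $\mathbb{C}$ generated by $\frac{1}{\sqrt2}$ and $i$. For each $k\ge 0$, let the Clifford+$T$ group on $k$ qubits be the group generated by the scalar $\omega=e^{i\pi/4}$, by the gates $$H=\frac{1}{\sqrt2}\begin{pmatrix}1&1\\1&-1\end{pmatrix},\qquad S=\begin{pmatrix}1&0\\0&i\end{pmatrix},\qquad T=\begin{pmatrix}1&0\\0&\omega\end{pmatrix}$$ applied to any one of the $k$ qubits, and by the controlled-not gate applied to any ordered pair of distinct qubits; its elements are the operators of Clifford+$T$ circuits on $k$ qubits. For $m\ge 0$, say that $U$ is exactly represented by a Clifford+$T$ circuit with $m$ ancillas initialized and finalized in state $|0\rangle$ if there is an element $U'$ of the Clifford+$T$ group on $n+m$ qubits such that $$U'(|\phi\rangle\otimes|0\cdots0\rangle)=(U|\phi\rangle)\otimes|0\cdots0\rangle$$ for all $n$-qubit states $|\phi\rangle$, where $|0\cdots0\rangle$ is the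 state of the $m$ ancillas. Then the following are equivalent: (a) $U$ is exactly represented by a Clifford+$T$ circuit with $m$ ancillas initialized and finalized in state $|0\rangle$, for some finite $m\ge 0$. (b) All entries of $U$ belong to $\mathbb{Z}[\frac{1}{\sqrt2},i]$. Moreover, in (a), a single ancilla is always sufficient: if (a) holds, then it holds with $m=1$. -/

import Mathlib

namespace CliffordT

noncomputable section

/-- Labels of the computational basis of `n` qubits: bit strings of length `n` (so there are
`2 ^ n` of them). -/
abbrev Bits (n : ℕ) : Type := Fin n → Fin 2

/-- Matrices of `n`-qubit operators, i.e. complex `2 ^ n × 2 ^ n` matrices, with rows and columns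
labelled by the computational basis. -/
abbrev Op (n : ℕ) : Type := Matrix (Bits n) (Bits n) ℂ

/-- State vectors of `n` qubits, in coordinates with respect to the computational basis. -/
abbrev Ket (n : ℕ) : Type := Bits n → ℂ

/-- The scalar `ω = e^{iπ/4}`. -/
def omega : ℂ := Complex.exp (Complex.I * Real.pi / 4)

/-- The Hadamard gate. -/
def gateH : Matrix (Fin 2) (Fin 2) ℂ :=
  ((1 : ℂ) / (Real.sqrt 2 : ℂ)) • !![1, 1; 1, -1]

/-- The phase gate. -/
def gateS : Matrix (Fin 2) (Fin 2) ℂ := !![1, 0; 0, Complex.I]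

/-- The `T`-gate. -/
def gateT : Matrix (Fin 2) (Fin 2) ℂ := !![1, 0; 0, omega]

/-- The one-qubit operator `g` applied to qubit `q` of an `n`-qubit register, the identity being
applied to all other qubits. -/
def onQubit {n : ℕ} (q : Fin n) (g : Matrix (Fin 2) (Fin 2) ℂ) : Op n :=
  Matrix.of fun x y => if ∀ j, j ≠ q → x j = y j then g (x q) (y q) else 0

/-- The controlled-not gate with control `c` and target `t` in an `n`-qubit register. It maps the
basis vector `y` to the one where the bit `y t` is replaced by `y t + y c` modulo 2. -/
def cnot {n : ℕ} (c t : Fin n) : Op n :=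
  Matrix.of fun x y => if x = Function.update y t (y t + y c) then 1 else 0

/-- The elementary Clifford+`T` gates on `n` qubits: the scalar `ω`, the gates `H`, `S`, `T` on any
qubit, and the controlled-not gate on any two distinct qubits. -/
inductive IsGate (n : ℕ) : Op n → Prop
  | omega : IsGate n (omega • (1 : Op n))
  | H (q : Fin n) : IsGate n (onQubit q gateH)
  | S (q : Fin n) : IsGate n (onQubit q gateS)
  | T (q : Fin n) : IsGate n (onQubit q gateT)
  | CNOT (c t : Fin n) (hct : c ≠ t) : IsGate n (cnot c t)

/-- The Clifford+`T` group on `n` qubits: the group generated by the elementary gates. Its elements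
are the operators of Clifford+`T` circuits on `n` qubits (without ancillas). -/
def cliffordTGroup (n : ℕ) : Subgroup (Matrix.unitaryGroup (Bits n) ℂ) :=
  Subgroup.closure {V | IsGate n (V : Op n)}

/-- The state `|0…0⟩` of `m` qubits. -/
def ketZero (m : ℕ) : Ket m := Pi.single 0 1

/-- The state `φ ⊗ ψ` of `n + m` qubits; `φ` is the state of the first `n` qubits and `ψ` that of
the last `m`. -/
def tensor {n m : ℕ} (φ : Ket n) (ψ : Ket m) : Ket (n + m) :=
  fun b => φ (fun i => b (Fin.castAdd m i)) * ψ (fun j => b (Fin.natAdd n j))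

/-- `U` is represented exactly by a Clifford+`T` circuit with `m` ancillas, all initialized and
finalized in state `|0⟩`. -/
def RepresentableWithAncillas {n : ℕ} (m : ℕ) (U : Op n) : Prop :=
  ∃ V ∈ cliffordTGroup (n + m), ∀ φ : Ket n,
    (V : Op (n + m)).mulVec (tensor φ (ketZero m)) = tensor (U.mulVec φ) (ketZero m)

/-- The ring `ℤ[1/√2, i]`, a subring of the complex numbers. -/
def entryRing : Subring ℂ := Subring.closure {(1 : ℂ) / (Real.sqrt 2 : ℂ), Complex.I}

end

end CliffordT

/-! Necessity: the generators have entries in `entryRing`, which is closed under complex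
conjugation, so every circuit does too; `U` is the block of the circuit matrix where all ancilla
bits are 0 (`entry_mem_of_representable`).

Sufficiency: the operators representable with one ancilla form a group, and `mem_of_entries_mem`
shows that this group is large enough because it contains the phase ω on a single basis vector, all
transpositions of basis vectors, and H on any pair of them. Commutators of controlled gates on a
common target are controlled by the conjunction of the conditions, which yields multiply controlled
gates without ancillas, but only of determinant 1: iX, iH and W = diag(ω, ω⁻¹). Aiming W at the
ancilla, which starts in |0⟩, turns it into a bare phase ω on one basis vector; such phases then
remove the factor i from iX and iH.

The synthesis reduces one column at a time (`reducible_of_pow_mul_mem`). Let π = 1 - ω. For a unit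
column v, some π^e v has entries in ℤ[ω]. If e ≥ 1, the squared norm (2 - √2)^e has even rational
part, and the parity of the rational part of |z|² detects divisibility of z by π; hence an entry of
π^e v not divisible by π has a partner of the same kind (`exists_pair_not_piDvd`). After a suitable
phase, H makes both divisible (`exists_piDvd_add_sub`). Once all entries are divisible, e drops; at
e = 0 a unit vector has a single nonzero entry, a power of ω. Every step fixes the basis vectors
outside the support of v, so finished columns are not disturbed. -/

namespace CliffordT

/-! ### One-qubit operators controlled by the other qubits -/

/-- The operator that applies to qubit `t` the one-qubit operator `f x`, where `x` is the
configuration of the other qubits. -/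
noncomputable def blockOp {N : ℕ} (t : Fin N) (f : Bits N → Matrix (Fin 2) (Fin 2) ℂ) : Op N :=
  Matrix.of fun x y => if ∀ j, j ≠ t → x j = y j then f x (x t) (y t) else 0

/-- `f x` does not depend on the bit `x t`. -/
def IgnoresBit {N : ℕ} {α : Type*} (t : Fin N) (f : Bits N → α) : Prop :=
  ∀ x b, f (Function.update x t b) = f x

lemma eq_update_of_agree {N : ℕ} {t : Fin N} {x y : Bits N} (h : ∀ j, j ≠ t → x j = y j) :
    y = Function.update x t (y t) := by
  funext j
  by_cases hj : j = t
  · subst hj; simp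
  · simp [hj, h j hj]

lemma IgnoresBit.eq_of_agree {N : ℕ} {α : Type*} {t : Fin N} {f : Bits N → α}
    (hf : IgnoresBit t f) {x y : Bits N} (h : ∀ j, j ≠ t → x j = y j) : f x = f y := by
  rw [eq_update_of_agree h, hf]

lemma blockOp_mulVec {N : ℕ} (t : Fin N) (f : Bits N → Matrix (Fin 2) (Fin 2) ℂ) (ψ : Ket N)
    (x : Bits N) :
    (blockOp t f).mulVec ψ x = ∑ b, f x (x t) b * ψ (Function.update x t b) := by
  simp only [Matrix.mulVec, dotProduct, blockOp, Matrix.of_apply, ite_mul, zero_mul]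
  rw [← Finset.sum_filter]
  symm
  refine Finset.sum_nbij (fun b => Function.update x t b) ?_ ?_ ?_ ?_
  · intro b _
    simp only [Finset.mem_filter, Finset.mem_univ, true_and]
    intro j hj
    simp [hj]
  · intro b _ c _ h
    simpa using congrFun h t
  · intro y hy
    simp only [Finset.coe_filter, Finset.mem_univ, true_and, Set.mem_ofPred_eq] at hy
    exact ⟨y t, by simp, (eq_update_of_agree hy).symm⟩
  · intro b _
    simp

/-- The intermediate configurations in the matrix product differ from the row index `x` at most in
bit `t`, and only `g` is evaluated at them; so only `g` has to ignore that bit. -/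
lemma blockOp_mul {N : ℕ} {t : Fin N} (f : Bits N → Matrix (Fin 2) (Fin 2) ℂ)
    {g : Bits N → Matrix (Fin 2) (Fin 2) ℂ} (hg : IgnoresBit t g) :
    blockOp t f * blockOp t g = blockOp t (fun x => f x * g x) := by
  ext x z
  have h := blockOp_mulVec t f (fun y => blockOp t g y z) x
  rw [show (blockOp t f * blockOp t g) x z
    = (blockOp t f).mulVec (fun y => blockOp t g y z) x from rfl, h]
  have h1 : ∀ b, (∀ j, j ≠ t → Function.update x t b j = z j) ↔ ∀ j, j ≠ t → x j = z j := by
    intro b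
    refine forall_congr' fun j => imp_congr_right fun hj => ?_
    simp [hj]
  simp only [blockOp, Matrix.of_apply, h1, hg x, Function.update_self, Matrix.mul_apply]
  split_ifs <;> simp

lemma blockOp_star {N : ℕ} {t : Fin N} {f : Bits N → Matrix (Fin 2) (Fin 2) ℂ}
    (hf : IgnoresBit t f) : star (blockOp t f) = blockOp t (fun x => star (f x)) := by
  ext x y
  simp only [Matrix.star_apply, blockOp, Matrix.of_apply]
  by_cases h : ∀ j, j ≠ t → x j = y j
  · rw [if_pos h, if_pos (fun j hj => (h j hj).symm), hf.eq_of_agree h]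
  · rw [if_neg h, if_neg (fun h' => h fun j hj => (h' j hj).symm), star_zero]

lemma blockOp_one {N : ℕ} (t : Fin N) : blockOp t (fun _ => 1) = (1 : Op N) := by
  ext x y
  simp only [blockOp, Matrix.of_apply, Matrix.one_apply]
  by_cases h : ∀ j, j ≠ t → x j = y j
  · rw [if_pos h]
    have : x t = y t ↔ x = y := by
      refine ⟨fun ht => funext fun j => ?_, fun e => e ▸ rfl⟩
      by_cases hj : j = t
      · rw [hj, ht]
      · exact h j hj
    simp [this]
  · rw [if_neg h, if_neg (fun e => h fun j _ => congrFun e j)]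

open Classical in
/-- The one-qubit operator `A` applied to qubit `t`, controlled by the condition `P` on the other
qubits. -/
noncomputable def ctrl {N : ℕ} (t : Fin N) (P : Bits N → Prop) (A : Matrix (Fin 2) (Fin 2) ℂ) :
    Op N :=
  blockOp t (fun x => if P x then A else 1)

lemma IgnoresBit.ite {N : ℕ} {t : Fin N} {P : Bits N → Prop} [DecidablePred P]
    (hP : IgnoresBit t P) (A : Matrix (Fin 2) (Fin 2) ℂ) :
    IgnoresBit t (fun x => if P x then A else 1) := by
  intro x b
  simp only [hP x b]

lemma ctrl_mul {N : ℕ} {t : Fin N} {P : Bits N → Prop} (hP : IgnoresBit t P)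
    (A B : Matrix (Fin 2) (Fin 2) ℂ) : ctrl t P A * ctrl t P B = ctrl t P (A * B) := by
  classical
  unfold ctrl
  rw [blockOp_mul _ (hP.ite B)]
  congr 1
  funext x
  split_ifs <;> simp

lemma ctrl_star {N : ℕ} {t : Fin N} {P : Bits N → Prop} (hP : IgnoresBit t P)
    (A : Matrix (Fin 2) (Fin 2) ℂ) : star (ctrl t P A) = ctrl t P (star A) := by
  classical
  unfold ctrl
  rw [blockOp_star (hP.ite A)]
  congr 1
  funext x
  split_ifs <;> simp

lemma ctrl_one {N : ℕ} (t : Fin N) (P : Bits N → Prop) : ctrl t P 1 = 1 := by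
  unfold ctrl
  simp [blockOp_one]

/-- If one of the two conditions fails, its pair of factors is trivial and the other pair cancels.
This is how controls are accumulated. -/
lemma ctrl_commutator {N : ℕ} {t : Fin N} {P Q : Bits N → Prop} (hP : IgnoresBit t P)
    (hQ : IgnoresBit t Q) {A A' B B' : Matrix (Fin 2) (Fin 2) ℂ} (hA : A * A' = 1)
    (hB : B * B' = 1) :
    ctrl t P A * ctrl t Q B * ctrl t P A' * ctrl t Q B'
      = ctrl t (fun x => P x ∧ Q x) (A * B * A' * B') := by
  classical
  unfold ctrl
  rw [blockOp_mul _ (hQ.ite B), blockOp_mul _ (hP.ite A'), blockOp_mul _ (hQ.ite B')]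
  congr 1
  funext x
  by_cases h1 : P x <;> by_cases h2 : Q x <;> simp [h1, h2, hA, hB]

lemma ctrl_conj {N : ℕ} {t : Fin N} {P : Bits N → Prop} (hP : IgnoresBit t P)
    {A A' : Matrix (Fin 2) (Fin 2) ℂ} (hA : A * A' = 1) (B : Matrix (Fin 2) (Fin 2) ℂ) :
    onQubit t A * ctrl t P B * onQubit t A' = ctrl t P (A * B * A') := by
  classical
  have h : ∀ C, onQubit t C = blockOp t (fun _ => C) := fun _ => rfl
  rw [h, h]
  unfold ctrl
  rw [blockOp_mul _ (hP.ite B), blockOp_mul _ (fun _ _ => rfl)]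
  congr 1
  funext x
  split_ifs <;> simp [hA]

lemma onQubit_eq_ctrl {N : ℕ} (t : Fin N) (A : Matrix (Fin 2) (Fin 2) ℂ) :
    onQubit t A = ctrl t (fun _ => True) A := by
  unfold ctrl
  simp only [if_true]
  rfl

lemma ignoresBit_true {N : ℕ} (t : Fin N) : IgnoresBit t (fun _ => True) := fun _ _ => rfl

lemma ignoresBit_eq {N : ℕ} {c t : Fin N} (h : c ≠ t) (a : Fin 2) :
    IgnoresBit t (fun x => x c = a) := by
  intro x b
  simp [h]

lemma cnot_eq_ctrl {N : ℕ} {c t : Fin N} (h : c ≠ t) :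
    cnot c t = ctrl t (fun x => x c = 1) !![0, 1; 1, 0] := by
  ext x y
  simp only [cnot, ctrl, blockOp, Matrix.of_apply]
  by_cases hxy : ∀ j, j ≠ t → x j = y j
  · rw [if_pos hxy]
    have : x = Function.update y t (y t + y c) ↔ x t = y t + x c := by
      rw [hxy c h]
      refine ⟨fun e => by simpa using congrFun e t, fun e => funext fun j => ?_⟩
      by_cases hj : j = t
      · subst hj; simpa using e
      · simpa [hj] using hxy j hj
    simp only [this]
    have hd : x c = 0 ∨ x c = 1 := by omega
    rcases hd with hd | hd <;> simp only [hd] <;> generalize x t = a, y t = b <;>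
      fin_cases a <;> fin_cases b <;> simp
  · rw [if_neg hxy, if_neg]
    intro e
    apply hxy
    intro j hj
    rw [e]
    simp [hj]

/-! ### Complex numbers -/

lemma sqrt_two_sq : ((Real.sqrt 2 : ℝ) : ℂ) ^ 2 = 2 := by
  rw [← Complex.ofReal_pow, Real.sq_sqrt (by norm_num)]; norm_num

lemma sqrt_two_ne_zero : ((Real.sqrt 2 : ℝ) : ℂ) ≠ 0 := by
  intro h
  have h2 := sqrt_two_sq
  rw [h] at h2
  norm_num at h2

lemma omega_eq : omega = ((1 : ℂ) / (Real.sqrt 2 : ℂ)) * (1 + Complex.I) := by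
  have h : Complex.I * Real.pi / 4 = ((Real.pi / 4 : ℝ) : ℂ) * Complex.I := by
    push_cast; ring
  have h2 := sqrt_two_sq
  have h0 := sqrt_two_ne_zero
  rw [omega, h, Complex.exp_mul_I, ← Complex.ofReal_cos, ← Complex.ofReal_sin,
    Real.cos_pi_div_four, Real.sin_pi_div_four]
  push_cast
  field_simp
  linear_combination (1 + Complex.I) * h2

lemma omega_sq : omega ^ 2 = Complex.I := by
  have h2 := sqrt_two_sq
  have h0 := sqrt_two_ne_zero
  rw [omega_eq]
  field_simp
  rw [h2]
  linear_combination Complex.I_sq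

lemma omega_pow_four : omega ^ 4 = -1 := by
  rw [show omega ^ 4 = (omega ^ 2) ^ 2 by ring, omega_sq, Complex.I_sq]

lemma omega_pow_eight : omega ^ 8 = 1 := by
  rw [show omega ^ 8 = (omega ^ 4) ^ 2 by ring, omega_pow_four]; norm_num

lemma omega_ne_zero : omega ≠ 0 := Complex.exp_ne_zero _

lemma star_omega : star omega = omega ^ 7 := by
  have h1 : star omega * omega = 1 := by
    rw [omega_eq]
    have h2 := sqrt_two_sq
    have h0 := sqrt_two_ne_zero
    simp only [star_mul', star_div₀, star_add, star_one, Complex.star_def, Complex.conj_ofReal,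
      Complex.conj_I]
    field_simp
    rw [h2]
    linear_combination -Complex.I_sq
  have h2 : omega ^ 7 * omega = 1 := by rw [← pow_succ, omega_pow_eight]
  exact mul_right_cancel₀ omega_ne_zero (h1.trans h2.symm)

lemma sqrt_two_eq : ((Real.sqrt 2 : ℝ) : ℂ) = omega - omega ^ 3 := by
  have h2 := sqrt_two_sq
  have h0 := sqrt_two_ne_zero
  rw [show omega - omega ^ 3 = omega * (1 - omega ^ 2) by ring, omega_sq, omega_eq]
  field_simp
  linear_combination h2 + Complex.I_sq

/-! ### Elementary gates as circuits -/

/-- `M` is the operator of a Clifford+`T` circuit without ancillas. -/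
def IsCircuit {N : ℕ} (M : Op N) : Prop := ∃ V ∈ cliffordTGroup N, (V : Op N) = M

lemma IsCircuit.mul {N : ℕ} {A B : Op N} (hA : IsCircuit A) (hB : IsCircuit B) :
    IsCircuit (A * B) := by
  obtain ⟨V, hV, rfl⟩ := hA
  obtain ⟨W, hW, rfl⟩ := hB
  exact ⟨V * W, mul_mem hV hW, rfl⟩

lemma IsCircuit.star {N : ℕ} {A : Op N} (hA : IsCircuit A) : IsCircuit (star A) := by
  obtain ⟨V, hV, rfl⟩ := hA
  exact ⟨V⁻¹, inv_mem hV, rfl⟩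

lemma IsCircuit.of_isGate {N : ℕ} {A : Op N} (hA : IsGate N A)
    (hu : A ∈ Matrix.unitaryGroup (Bits N) ℂ) : IsCircuit A :=
  ⟨⟨A, hu⟩, Subgroup.subset_closure hA, rfl⟩

lemma ctrl_mem_unitaryGroup {N : ℕ} {t : Fin N} {P : Bits N → Prop} (hP : IgnoresBit t P)
    {A : Matrix (Fin 2) (Fin 2) ℂ} (hA : A * star A = 1) :
    ctrl t P A ∈ Matrix.unitaryGroup (Bits N) ℂ := by
  rw [Matrix.mem_unitaryGroup_iff, ctrl_star hP, ctrl_mul hP, hA, ctrl_one]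

/-- The one-qubit `X`-gate. -/
noncomputable def gateX : Matrix (Fin 2) (Fin 2) ℂ := !![0, 1; 1, 0]

lemma star_two (a b c d : ℂ) : star !![a, b; c, d] = !![star a, star c; star b, star d] := by
  ext i j
  fin_cases i <;> fin_cases j <;> rfl

lemma one_two : (1 : Matrix (Fin 2) (Fin 2) ℂ) = !![1, 0; 0, 1] := Matrix.one_fin_two

lemma inv_sqrt_two_sq : ((1 : ℂ) / (Real.sqrt 2 : ℂ)) ^ 2 = 1 / 2 := by
  rw [div_pow, sqrt_two_sq, one_pow]

lemma gateH_eq : gateH = !![1 / (Real.sqrt 2 : ℂ), 1 / (Real.sqrt 2 : ℂ);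
    1 / (Real.sqrt 2 : ℂ), -(1 / (Real.sqrt 2 : ℂ))] := by
  rw [gateH]
  simp

lemma star_gateH : star gateH = gateH := by
  rw [gateH_eq, star_two]
  simp

lemma gateH_mul_gateH : gateH * gateH = 1 := by
  have h := inv_sqrt_two_sq
  rw [gateH_eq, Matrix.mul_fin_two, one_two]
  generalize (1 : ℂ) / (Real.sqrt 2 : ℂ) = r at *
  congr 1
  have h2 : r * r + r * r = 1 := by linear_combination 2 * h
  have h3 : r * r + -r * -r = 1 := by linear_combination 2 * h
  simp [h2]

lemma gateS_mul_star : gateS * star gateS = 1 := by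
  rw [gateS, star_two, Matrix.mul_fin_two, one_two]
  simp

lemma gateT_mul_star : gateT * star gateT = 1 := by
  rw [gateT, star_two, Matrix.mul_fin_two, one_two, star_omega, ← pow_succ', omega_pow_eight]
  simp

lemma gateX_mul_star : gateX * star gateX = 1 := by
  rw [gateX, star_two, Matrix.mul_fin_two, one_two]
  simp

lemma isCircuit_gateH {N : ℕ} (t : Fin N) : IsCircuit (onQubit t gateH) := by
  refine .of_isGate (.H t) ?_
  rw [onQubit_eq_ctrl]
  exact ctrl_mem_unitaryGroup (ignoresBit_true t) (by rw [star_gateH, gateH_mul_gateH])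

lemma isCircuit_gateS {N : ℕ} (t : Fin N) : IsCircuit (onQubit t gateS) := by
  refine .of_isGate (.S t) ?_
  rw [onQubit_eq_ctrl]
  exact ctrl_mem_unitaryGroup (ignoresBit_true t) gateS_mul_star

lemma isCircuit_gateT {N : ℕ} (t : Fin N) : IsCircuit (onQubit t gateT) := by
  refine .of_isGate (.T t) ?_
  rw [onQubit_eq_ctrl]
  exact ctrl_mem_unitaryGroup (ignoresBit_true t) gateT_mul_star

lemma isCircuit_cnot {N : ℕ} {c t : Fin N} (h : c ≠ t) : IsCircuit (cnot c t) := by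
  refine .of_isGate (.CNOT c t h) ?_
  rw [cnot_eq_ctrl h]
  exact ctrl_mem_unitaryGroup (ignoresBit_eq h 1) gateX_mul_star

lemma isCircuit_omega {N : ℕ} : IsCircuit (omega • (1 : Op N)) := by
  refine .of_isGate .omega ?_
  rw [Matrix.mem_unitaryGroup_iff, star_smul, star_one, smul_mul_smul_comm, star_omega,
    ← pow_succ', omega_pow_eight, one_mul, one_smul]

lemma onQubit_mul {N : ℕ} (t : Fin N) (A B : Matrix (Fin 2) (Fin 2) ℂ) :
    onQubit t (A * B) = onQubit t A * onQubit t B := by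
  simp only [onQubit_eq_ctrl]
  rw [ctrl_mul (ignoresBit_true t)]

lemma onQubit_star {N : ℕ} (t : Fin N) (A : Matrix (Fin 2) (Fin 2) ℂ) :
    onQubit t (star A) = star (onQubit t A) := by
  simp only [onQubit_eq_ctrl]
  rw [ctrl_star (ignoresBit_true t)]

lemma onQubit_smul {N : ℕ} (t : Fin N) (a : ℂ) (A : Matrix (Fin 2) (Fin 2) ℂ) :
    onQubit t (a • A) = (a • (1 : Op N)) * onQubit t A := by
  rw [smul_mul_assoc, one_mul]
  ext x y
  simp [onQubit]

/-! ### Multiply controlled gates without ancillas -/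

/-- The gate `iX`. -/
noncomputable def gateIX : Matrix (Fin 2) (Fin 2) ℂ := !![0, Complex.I; Complex.I, 0]

/-- The gate `diag(ω, ω⁻¹)`. -/
noncomputable def gateW : Matrix (Fin 2) (Fin 2) ℂ := !![omega, 0; 0, star omega]

lemma gateX_eq : gateX = gateH * (gateS * gateS) * gateH := by
  have h := inv_sqrt_two_sq
  rw [gateH_eq, gateS, gateX]
  simp only [Matrix.mul_fin_two]
  generalize (1 : ℂ) / (Real.sqrt 2 : ℂ) = r at *
  ext i j
  fin_cases i <;> fin_cases j <;> simp
  · linear_combination -2 * h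
  · linear_combination -2 * h

lemma isCircuit_gateX {N : ℕ} (t : Fin N) : IsCircuit (onQubit t gateX) := by
  rw [gateX_eq, onQubit_mul, onQubit_mul, onQubit_mul]
  exact ((isCircuit_gateH t).mul ((isCircuit_gateS t).mul (isCircuit_gateS t))).mul
    (isCircuit_gateH t)

lemma isCircuit_gateIX {N : ℕ} (t : Fin N) : IsCircuit (onQubit t gateIX) := by
  have : gateIX = omega • omega • gateX := by
    rw [smul_smul, ← sq, omega_sq, gateIX, gateX]
    simp
  rw [this, onQubit_smul, onQubit_smul]
  exact isCircuit_omega.mul (isCircuit_omega.mul (isCircuit_gateX t))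

lemma omega_mul_star : omega * star omega = 1 := by
  rw [star_omega, ← pow_succ', omega_pow_eight]

lemma star_mul_omega : star omega * omega = 1 := by
  rw [mul_comm, omega_mul_star]

lemma star_omega_sq : star omega ^ 2 = -Complex.I := by
  rw [← star_pow, omega_sq]; simp

lemma gateX_commutator_gateT :
    gateX * gateT * star gateX * star gateT = gateW := by
  rw [gateX, gateT, gateW]
  simp only [star_two, Matrix.mul_fin_two]
  simp

lemma gateIX_commutator_gateT :
    gateIX * gateT * star gateIX * star gateT = gateW := by
  rw [gateIX, gateT, gateW]
  simp only [star_two, Matrix.mul_fin_two]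
  have hI := Complex.I_mul_I
  ext i j
  fin_cases i <;> fin_cases j <;> simp
  linear_combination -omega * hI

lemma gateW_mul_star : gateW * star gateW = 1 := by
  rw [gateW, star_two, Matrix.mul_fin_two, one_two]
  have h := omega_mul_star
  have h' := star_mul_omega
  simp only [star_star, h, h']
  simp

lemma gateIX_mul_star : gateIX * star gateIX = 1 := by
  rw [gateIX, star_two, Matrix.mul_fin_two, one_two]
  simp

lemma gateIX_commutator_gateW :
    gateIX * gateW * star gateIX * star gateW = !![-Complex.I, 0; 0, Complex.I] := by
  rw [gateIX, gateW]
  have h1 := omega_sq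
  have h2 := star_omega_sq
  have hI := Complex.I_mul_I
  simp only [star_two, Matrix.mul_fin_two, star_star]
  ext i j
  fin_cases i <;> fin_cases j <;> simp <;> simp at h2
  · linear_combination hI * (starRingEnd ℂ) omega ^ 2 - h2
  · linear_combination h1 - hI * omega ^ 2

/-- This closes the induction on the number of controls: the commutator of iX and W is the inverse
of iZ, and conjugating iZ by H returns iX. -/
lemma gateH_conj_gateIZ :
    gateH * star !![-Complex.I, 0; 0, Complex.I] * gateH = gateIX := by
  have h := inv_sqrt_two_sq
  rw [gateH_eq, gateIX, star_two]
  simp only [Matrix.mul_fin_two]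
  generalize (1 : ℂ) / (Real.sqrt 2 : ℂ) = r at *
  ext i j
  fin_cases i <;> fin_cases j <;> simp
  · linear_combination 2 * Complex.I * h
  · linear_combination 2 * Complex.I * h

lemma isCircuit_ctrl_gateW {N : ℕ} {c t : Fin N} (h : c ≠ t) (a : Fin 2) :
    IsCircuit (ctrl t (fun x => x c = a) gateW) := by
  have h1 : IsCircuit (ctrl t (fun x => x c = 1) gateW) := by
    have := ctrl_commutator (ignoresBit_eq h 1) (ignoresBit_true t) gateX_mul_star gateT_mul_star
    rw [gateX_commutator_gateT, ← ctrl_star (ignoresBit_eq h 1), ← ctrl_star (ignoresBit_true t),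
      ← onQubit_eq_ctrl] at this
    simp only [and_true] at this
    rw [← this, gateX, ← cnot_eq_ctrl h]
    exact (((isCircuit_cnot h).mul (isCircuit_gateT t)).mul (isCircuit_cnot h).star).mul
      (isCircuit_gateT t).star
  have hW : IsCircuit (onQubit t gateW) := by
    rw [← gateX_commutator_gateT]
    simp only [onQubit_mul, onQubit_star]
    exact (((isCircuit_gateX t).mul (isCircuit_gateT t)).mul (isCircuit_gateX t).star).mul
      (isCircuit_gateT t).star
  have ha : a = 0 ∨ a = 1 := by omega
  rcases ha with rfl | rfl
  -- A control on 0 is the uncontrolled gate followed or preceded by the inverse of the gate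
  -- controlled on 1.
  · have : ctrl t (fun x => x c = 0) gateW
        = onQubit t gateW * star (ctrl t (fun x => x c = 1) gateW) := by
      classical
      rw [ctrl_star (ignoresBit_eq h 1), onQubit_eq_ctrl]
      unfold ctrl
      rw [blockOp_mul]
      swap
      · exact fun x b => by simp [h]
      congr 1
      funext x
      have hx : x c = 0 ∨ x c = 1 := by omega
      rcases hx with hx | hx <;> simp [hx, gateW_mul_star]
    rw [this]
    exact hW.mul h1.star
  · exact h1

lemma ignoresBit_pattern {N : ℕ} {t : Fin N} {s : Finset (Fin N)} (ht : t ∉ s) (p : Bits N) :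
    IgnoresBit t (fun x => ∀ j ∈ s, x j = p j) := by
  intro x b
  refine propext (forall_congr' fun j => imp_congr_right fun hj => ?_)
  have : j ≠ t := fun e => ht (e ▸ hj)
  simp [this]

/-- The multiply controlled `iX`-gate needs no ancilla. -/
lemma isCircuit_ctrl_gateIX {N : ℕ} {t : Fin N} (s : Finset (Fin N)) (ht : t ∉ s) (p : Bits N) :
    IsCircuit (ctrl t (fun x => ∀ j ∈ s, x j = p j) gateIX) := by
  induction s using Finset.induction_on with
  | empty =>
    simp only [Finset.notMem_empty, false_imp_iff, imp_true_iff]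
    rw [← onQubit_eq_ctrl]
    exact isCircuit_gateIX t
  | insert c s hc ih =>
    simp only [Finset.mem_insert, not_or] at ht
    have hct : c ≠ t := fun e => ht.1 e.symm
    specialize ih ht.2
    have hW := isCircuit_ctrl_gateW hct (p c)
    have hs := ignoresBit_pattern ht.2 p
    have hi := ignoresBit_eq hct (p c)
    -- The old controls sit on iX and the new one on W, so the commutator fires only when all of
    -- them are satisfied.
    have key := ctrl_commutator hs hi gateIX_mul_star gateW_mul_star
    have hP : (fun x : Bits N => (∀ j ∈ s, x j = p j) ∧ x c = p c)
        = fun x => ∀ j ∈ insert c s, x j = p j := by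
      funext x
      simp only [Finset.forall_mem_insert]
      exact propext and_comm
    rw [gateIX_commutator_gateW, hP, ← ctrl_star hs, ← ctrl_star hi] at key
    have hs' : IgnoresBit t (fun x => ∀ j ∈ insert c s, x j = p j) :=
      ignoresBit_pattern (by simp [ht.1, ht.2]) p
    rw [← gateH_conj_gateIZ, ← ctrl_conj hs' gateH_mul_gateH, ← ctrl_star hs', ← key]
    exact ((isCircuit_gateH t).mul ((((ih.mul hW).mul ih.star).mul hW.star).star)).mul
      (isCircuit_gateH t)

lemma isCircuit_ctrl_gateW_pattern {N : ℕ} {t : Fin N} (s : Finset (Fin N)) (ht : t ∉ s)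
    (p : Bits N) : IsCircuit (ctrl t (fun x => ∀ j ∈ s, x j = p j) gateW) := by
  have hs := ignoresBit_pattern ht p
  have key := ctrl_commutator hs (ignoresBit_true t) gateIX_mul_star gateT_mul_star
  rw [gateIX_commutator_gateT, ← ctrl_star hs, ← ctrl_star (ignoresBit_true t),
    ← onQubit_eq_ctrl] at key
  simp only [and_true] at key
  rw [← key]
  have h := isCircuit_ctrl_gateIX s ht p
  exact ((h.mul (isCircuit_gateT t)).mul h.star).mul (isCircuit_gateT t).star

/-- Both iX and iH have determinant 1 and trace 0, so they are unitarily conjugate; here the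
conjugating operator is itself a circuit and needs no control. -/
lemma conj_gateIX_eq : (gateS * gateH * gateT) * gateIX * star (gateS * gateH * gateT)
    = Complex.I • gateH := by
  have h := inv_sqrt_two_sq
  have hI := Complex.I_mul_I
  have hw : omega = ((1 : ℂ) / (Real.sqrt 2 : ℂ)) * (1 + Complex.I) := omega_eq
  rw [gateH_eq, gateS, gateT, gateIX]
  simp only [star_two, Matrix.mul_fin_two, hw]
  have hr : star ((1 : ℂ) / (Real.sqrt 2 : ℂ)) = (1 : ℂ) / (Real.sqrt 2 : ℂ) := by simp
  simp only [star_mul', star_add, star_one, star_neg, hr]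
  generalize (1 : ℂ) / (Real.sqrt 2 : ℂ) = r at *
  simp only [Complex.star_def, Complex.conj_I, star_zero, Matrix.smul_of, Matrix.smul_cons,
    Matrix.smul_empty, smul_eq_mul]
  ext i j
  fin_cases i <;> fin_cases j <;> simp
  · linear_combination 2 * r * Complex.I * h
  · linear_combination 2 * r * Complex.I * h - 2 * r ^ 3 * Complex.I * hI
  · linear_combination 2 * r * Complex.I * h - 2 * r ^ 3 * Complex.I * hI
  · linear_combination -2 * r * Complex.I * h + 2 * r ^ 3 * Complex.I * hI

lemma isCircuit_ctrl_gateIH {N : ℕ} {t : Fin N} (s : Finset (Fin N)) (ht : t ∉ s) (p : Bits N) :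
    IsCircuit (ctrl t (fun x => ∀ j ∈ s, x j = p j) (Complex.I • gateH)) := by
  have hs := ignoresBit_pattern ht p
  have hA : (gateS * gateH * gateT) * star (gateS * gateH * gateT) = 1 := by
    simp only [star_mul, star_gateH]
    calc gateS * gateH * gateT * (star gateT * (gateH * star gateS))
        = gateS * (gateH * (gateT * star gateT) * gateH) * star gateS := by
          simp only [mul_assoc]
      _ = 1 := by rw [gateT_mul_star, mul_one, gateH_mul_gateH, mul_one, gateS_mul_star]
  rw [← conj_gateIX_eq, ← ctrl_conj hs hA, onQubit_star, onQubit_mul, onQubit_mul]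
  have h := ((isCircuit_gateS t).mul (isCircuit_gateH t)).mul (isCircuit_gateT t)
  exact (h.mul (isCircuit_ctrl_gateIX s ht p)).mul h.star

/-! ### Vector transformations realized by a group -/

/-- The transformation `f` of vectors is multiplication by an element of `G`. -/
def Realizes {ι : Type*} [Fintype ι] [DecidableEq ι] (G : Subgroup (Matrix.unitaryGroup ι ℂ))
    (f : (ι → ℂ) → ι → ℂ) : Prop :=
  ∃ g ∈ G, ∀ v, (g : Matrix ι ι ℂ).mulVec v = f v

lemma Realizes.comp {ι : Type*} [Fintype ι] [DecidableEq ι]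
    {G : Subgroup (Matrix.unitaryGroup ι ℂ)} {f f' : (ι → ℂ) → ι → ℂ}
    (hf : Realizes G f) (hf' : Realizes G f') : Realizes G (fun v => f (f' v)) := by
  obtain ⟨g, hg, h⟩ := hf
  obtain ⟨g', hg', h'⟩ := hf'
  refine ⟨g * g', mul_mem hg hg', fun v => ?_⟩
  change _ = f (f' v)
  rw [← h, ← h', Matrix.mulVec_mulVec]
  rfl

lemma Realizes.id {ι : Type*} [Fintype ι] [DecidableEq ι]
    (G : Subgroup (Matrix.unitaryGroup ι ℂ)) : Realizes G (fun v => v) :=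
  ⟨1, one_mem G, fun v => by simp⟩

/-- The two-by-two matrix `A` applied to the coordinates `a` and `b` of a vector. -/
def twoLevel {ι : Type*} [DecidableEq ι] (a b : ι) (A : Matrix (Fin 2) (Fin 2) ℂ) (v : ι → ℂ) :
    ι → ℂ :=
  Function.update (Function.update v a (A 0 0 * v a + A 0 1 * v b)) b (A 1 0 * v a + A 1 1 * v b)

/-- Multiplication of the coordinate `a` of a vector by `c`. -/
def oneLevel {ι : Type*} [DecidableEq ι] (a : ι) (c : ℂ) (v : ι → ℂ) : ι → ℂ :=
  Function.update v a (c * v a)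

/-! ### Operators represented with ancillas -/

lemma tensor_append {n m : ℕ} (φ : Ket n) (ψ : Ket m) (x : Bits n) (z : Bits m) :
    tensor φ ψ (Fin.append x z) = φ x * ψ z := by
  simp [tensor]

lemma ketZero_zero (m : ℕ) : ketZero m 0 = 1 := by simp [ketZero]

lemma forall_bits_append {n m : ℕ} {P : Bits (n + m) → Prop} :
    (∀ b, P b) ↔ ∀ x z, P (Fin.append x z) := by
  refine ⟨fun h x z => h _, fun h b => ?_⟩
  rw [← Fin.append_castAdd_natAdd (f := b)]
  exact h _ _

lemma sum_bits_append {n m : ℕ} (F : Bits (n + m) → ℂ) :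
    ∑ b, F b = ∑ x : Bits n, ∑ z : Bits m, F (Fin.append x z) := by
  rw [← Fintype.sum_prod_type', ← (Fin.appendEquiv n m).sum_comp]
  rfl

lemma tensor_ketZero_dot {n m : ℕ} (φ : Ket n) (F : Bits (n + m) → ℂ) :
    ∑ b, F b * tensor φ (ketZero m) b = ∑ x, F (Fin.append x 0) * φ x := by
  rw [sum_bits_append]
  refine Finset.sum_congr rfl fun x _ => ?_
  rw [Finset.sum_eq_single (0 : Bits m)]
  · rw [tensor_append, ketZero_zero, mul_one]
  · intro z _ hz
    rw [tensor_append, ketZero, Pi.single_eq_of_ne hz]; ring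
  · simp

lemma mulVec_tensor_append {n m : ℕ} (M : Op (n + m)) (φ : Ket n) (x : Bits n) :
    M.mulVec (tensor φ (ketZero m)) (Fin.append x 0)
      = ∑ y, M (Fin.append x 0) (Fin.append y 0) * φ y := by
  rw [Matrix.mulVec, dotProduct, tensor_ketZero_dot]

lemma eq_of_represented {n m : ℕ} {M : Op (n + m)} {U : Op n}
    (h : ∀ φ : Ket n, M.mulVec (tensor φ (ketZero m)) = tensor (U.mulVec φ) (ketZero m))
    (x y : Bits n) : U x y = M (Fin.append x 0) (Fin.append y 0) := by
  have h1 := congrFun (h (Pi.single y 1)) (Fin.append x 0)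
  rw [mulVec_tensor_append, tensor_append, ketZero_zero] at h1
  simpa [Pi.single_apply] using h1.symm

lemma mulVec_star_dot {ι : Type*} [Fintype ι] [DecidableEq ι] (M : Matrix ι ι ℂ) (v w : ι → ℂ) :
    dotProduct (star (M.mulVec v)) (M.mulVec w) = dotProduct (star v) ((star M * M).mulVec w) := by
  rw [Matrix.star_mulVec, ← Matrix.mulVec_mulVec, Matrix.dotProduct_mulVec,
    Matrix.dotProduct_mulVec, Matrix.dotProduct_mulVec]
  rfl

/-- The map φ ↦ φ ⊗ |0…0⟩ preserves inner products, so unitarity passes from `M` to `U`. -/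
lemma mem_unitaryGroup_of_represented {n m : ℕ} {M : Op (n + m)}
    (hM : M ∈ Matrix.unitaryGroup (Bits (n + m)) ℂ) {U : Op n}
    (h : ∀ φ : Ket n, M.mulVec (tensor φ (ketZero m)) = tensor (U.mulVec φ) (ketZero m)) :
    U ∈ Matrix.unitaryGroup (Bits n) ℂ := by
  have hdot : ∀ φ ψ : Ket n, dotProduct (star (tensor φ (ketZero m))) (tensor ψ (ketZero m))
      = dotProduct (star φ) ψ := by
    intro φ ψ
    rw [dotProduct, tensor_ketZero_dot]
    simp [dotProduct, tensor_append, ketZero_zero]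
  rw [Matrix.mem_unitaryGroup_iff'] at hM ⊢
  ext x y
  have h1 := mulVec_star_dot U (Pi.single x 1) (Pi.single y 1)
  rw [← hdot, ← h, ← h, mulVec_star_dot, hM, Matrix.one_mulVec, hdot] at h1
  have h2 : ∀ N : Op n, dotProduct (star (Pi.single x (1 : ℂ))) (N.mulVec (Pi.single y 1))
      = N x y := by
    intro N
    rw [← Pi.single_star]
    simp
  exact (h2 (star U * U)).symm.trans (h1.symm.trans (by rw [← h2 1, Matrix.one_mulVec]))

/-- The unitary operators on `n` qubits that are represented with one ancilla. -/
def oneAncillaGroup (n : ℕ) : Subgroup (Matrix.unitaryGroup (Bits n) ℂ) where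
  carrier := {U | RepresentableWithAncillas 1 (U : Op n)}
  one_mem' := ⟨1, one_mem _, fun φ => by simp⟩
  mul_mem' := by
    rintro A B ⟨V, hV, h⟩ ⟨W, hW, h'⟩
    refine ⟨V * W, mul_mem hV hW, fun φ => ?_⟩
    change ((V : Op (n + 1)) * (W : Op (n + 1))).mulVec _
      = tensor (((A : Op n) * (B : Op n)).mulVec φ) _
    rw [← Matrix.mulVec_mulVec, h', h, Matrix.mulVec_mulVec]
  inv_mem' := by
    rintro A ⟨V, hV, h⟩
    refine ⟨V⁻¹, inv_mem hV, fun φ => ?_⟩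
    have h1 : φ = (A : Op n).mulVec
        (((A⁻¹ : Matrix.unitaryGroup (Bits n) ℂ) : Op n).mulVec φ) := by
      rw [Matrix.mulVec_mulVec]
      change φ = ((A * A⁻¹ : Matrix.unitaryGroup (Bits n) ℂ) : Op n).mulVec φ
      simp
    conv_lhs => rw [h1]
    rw [← h, Matrix.mulVec_mulVec]
    change ((V⁻¹ * V : Matrix.unitaryGroup (Bits (n + 1)) ℂ) : Op (n + 1)).mulVec _ = _
    simp

lemma realizes_of_isCircuit {n : ℕ} {M : Op (n + 1)} (hM : IsCircuit M) {f : Ket n → Ket n}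
    (h : ∀ φ, M.mulVec (tensor φ (ketZero 1)) = tensor (f φ) (ketZero 1)) :
    Realizes (oneAncillaGroup n) f := by
  obtain ⟨V, hV, rfl⟩ := hM
  let U : Op n := Matrix.of fun x y => (V : Op (n + 1)) (Fin.append x 0) (Fin.append y 0)
  have hU : ∀ φ, U.mulVec φ = f φ := by
    intro φ
    funext x
    have := congrFun (h φ) (Fin.append x 0)
    rw [mulVec_tensor_append, tensor_append, ketZero_zero, mul_one] at this
    rw [← this]
    rfl
  have hr : ∀ φ : Ket n, (V : Op (n + 1)).mulVec (tensor φ (ketZero 1))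
      = tensor (U.mulVec φ) (ketZero 1) := fun φ => by rw [h, hU]
  exact ⟨⟨U, mem_unitaryGroup_of_represented V.2 hr⟩, ⟨V, hV, hr⟩, hU⟩

lemma ctrl_mulVec {N : ℕ} (t : Fin N) (P : Bits N → Prop) (A : Matrix (Fin 2) (Fin 2) ℂ)
    (ψ : Ket N) (x : Bits N) [Decidable (P x)] :
    (ctrl t P A).mulVec ψ x
      = if P x then A (x t) 0 * ψ (Function.update x t 0) + A (x t) 1 * ψ (Function.update x t 1)
        else ψ x := by
  rw [ctrl, blockOp_mulVec]
  by_cases h : P x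
  · simp [h, Fin.sum_univ_two]
  · simp [h, Matrix.one_apply]

lemma fin_bits_one (z : Bits 1) : z = 0 ∨ z = 1 := by
  have : z 0 = 0 ∨ z 0 = 1 := by omega
  refine this.imp (fun h => ?_) (fun h => ?_) <;>
  · funext i
    rw [Subsingleton.elim i 0, h]
    rfl

lemma realizes_oneLevel {n : ℕ} (a : Bits n) :
    Realizes (oneAncillaGroup n) (oneLevel a omega) := by
  classical
  -- The target is the ancilla and the controls are all data qubits. The ancilla is in state |0⟩, so
  -- only the entry ω of W is seen.
  have hc := isCircuit_ctrl_gateW_pattern (N := n + 1) (t := Fin.natAdd n 0)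
    (Finset.univ.erase (Fin.natAdd n 0)) (by simp) (Fin.append a 0)
  refine realizes_of_isCircuit hc fun φ => ?_
  funext b
  revert b
  rw [forall_bits_append]
  intro x z
  have hP : (∀ j ∈ Finset.univ.erase (Fin.natAdd n (0 : Fin 1)),
      Fin.append x z j = Fin.append a 0 j) ↔ x = a := by
    constructor
    · intro h
      funext i
      have := h (Fin.castAdd 1 i) (by
        simp only [Finset.mem_erase, Finset.mem_univ, and_true]
        intro e
        have := congrArg Fin.val e
        simp at this
        omega)
      simpa using this
    · rintro rfl j hj
      induction j using Fin.addCases with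
      | left i => simp
      | right i => simp [Subsingleton.elim i 0] at hj
  rw [ctrl_mulVec]
  simp only [hP]
  have hu : ∀ c, Function.update (Fin.append x z) (Fin.natAdd n 0) c
      = Fin.append x (fun _ => c) := by
    intro c
    funext j
    induction j using Fin.addCases with
    | left i =>
      have : Fin.castAdd 1 i ≠ Fin.natAdd n 0 := by
        intro e
        have := congrArg Fin.val e
        simp at this
        omega
      simp [this]
    | right i => simp [Subsingleton.elim i 0]
  have h0 : ketZero 1 (fun _ => 0) = 1 := ketZero_zero 1
  have h1 : ketZero 1 (fun _ => 1) = 0 := by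
    rw [ketZero, Pi.single_eq_of_ne]
    intro e
    simpa using congrFun e 0
  simp only [hu, tensor_append, h0, h1]
  by_cases hx : x = a
  · subst hx
    rcases fin_bits_one z with rfl | rfl
    · simp [oneLevel, gateW, ketZero_zero]
    · have : ketZero 1 1 = 0 := h1
      simp [gateW, this]
  · simp [hx, oneLevel]

/-- The target is data qubit `i`; all other qubits, the ancilla included, are controls. Their
pattern leaves exactly the two basis vectors that differ from `a` at most in bit `i`. -/
lemma realizes_ctrl {n : ℕ} (i : Fin n) (a : Bits n) (ha : a i = 0)
    {A : Matrix (Fin 2) (Fin 2) ℂ}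
    (hc : IsCircuit (ctrl (Fin.castAdd 1 i) (fun x => ∀ j ∈ Finset.univ.erase (Fin.castAdd 1 i),
      x j = Fin.append a 0 j) A)) :
    Realizes (oneAncillaGroup n) (twoLevel a (Function.update a i 1) A) := by
  classical
  refine realizes_of_isCircuit hc fun φ => ?_
  funext b
  revert b
  rw [forall_bits_append]
  intro x z
  have hP : (∀ j ∈ Finset.univ.erase (Fin.castAdd 1 i),
      Fin.append x z j = Fin.append a 0 j) ↔ (∀ j, j ≠ i → x j = a j) ∧ z = 0 := by
    constructor
    · intro h
      refine ⟨fun j hj => ?_, ?_⟩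
      · simpa using h (Fin.castAdd 1 j) (by simpa using hj)
      · funext k
        have := h (Fin.natAdd n k) (by
          simp only [Finset.mem_erase, Finset.mem_univ, and_true]
          intro e
          have := congrArg Fin.val e
          simp at this
          omega)
        simpa using this
    · rintro ⟨h, rfl⟩ j hj
      induction j using Fin.addCases with
      | left k => simpa using h k (by simpa using hj)
      | right k => simp
  rw [ctrl_mulVec]
  simp only [hP]
  have hu : ∀ c, Function.update (Fin.append x z) (Fin.castAdd 1 i) c
      = Fin.append (Function.update x i c) z := by
    intro c
    funext j
    induction j using Fin.addCases with
    | left k =>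
      by_cases hk : k = i
      · subst hk; simp
      · simp [hk]
    | right k =>
      have : Fin.natAdd n k ≠ Fin.castAdd 1 i := by
        intro e
        have := congrArg Fin.val e
        simp at this
        omega
      simp [this]
  simp only [hu, tensor_append, Fin.append_left]
  have h1 : ketZero 1 1 = 0 := by
    rw [ketZero, Pi.single_eq_of_ne]
    intro e
    simpa using congrFun e 0
  rcases fin_bits_one z with rfl | rfl
  swap
  · simp [h1]
  rw [ketZero_zero]
  simp only [mul_one, and_true]
  by_cases hx : ∀ j, j ≠ i → x j = a j
  · rw [if_pos hx]
    have hxa : ∀ c, Function.update x i c = Function.update a i c := by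
      intro c
      funext j
      by_cases hj : j = i
      · subst hj; simp
      · simp [hj, hx j hj]
    have ha0 : Function.update a i 0 = a := by rw [← ha, Function.update_eq_self]
    have hne : a ≠ Function.update a i 1 := by
      intro e
      have := congrFun e i
      simp [ha] at this
    rw [hxa, hxa, ha0]
    have hxi : x i = 0 ∨ x i = 1 := by omega
    have hxe : x = Function.update a i (x i) := by rw [← hxa, Function.update_eq_self]
    rcases hxi with h | h
    · have : x = a := by rw [hxe, h, ha0]
      subst this
      simp [twoLevel, h, hne]
    · rw [h] at hxe
      rw [h, hxe]
      simp [twoLevel]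
  · rw [if_neg hx]
    have h2 : x ≠ a := fun e => hx (fun j _ => by rw [e])
    have h3 : x ≠ Function.update a i 1 := fun e => hx (fun j hj => by rw [e]; simp [hj])
    simp [twoLevel, h2, h3]

/-! ### Phases, permutations and two-level Hadamard gates with one ancilla -/

lemma realizes_oneLevel_pow {ι : Type*} [Fintype ι] [DecidableEq ι]
    {G : Subgroup (Matrix.unitaryGroup ι ℂ)} {a : ι} {c : ℂ} (h : Realizes G (oneLevel a c))
    (m : ℕ) : Realizes G (oneLevel a (c ^ m)) := by
  induction m with
  | zero => convert Realizes.id G using 2; simp [oneLevel]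
  | succ m ih =>
    convert ih.comp h using 2
    simp [oneLevel, pow_succ, mul_assoc]

lemma omega_pow_six : omega ^ 6 = -Complex.I := by
  rw [show omega ^ 6 = omega ^ 4 * omega ^ 2 by ring, omega_pow_four, omega_sq]; ring

lemma realizes_neg_I_smul {ι : Type*} [Fintype ι] [DecidableEq ι]
    {G : Subgroup (Matrix.unitaryGroup ι ℂ)} (h : ∀ a, Realizes G (oneLevel a omega)) {a b : ι}
    (hab : a ≠ b) {A : Matrix (Fin 2) (Fin 2) ℂ} (hA : Realizes G (twoLevel a b (Complex.I • A))) :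
    Realizes G (twoLevel a b A) := by
  -- Since ω⁶ = -i, these phases on both levels cancel the factor i.
  have := ((realizes_oneLevel_pow (h a) 6).comp (realizes_oneLevel_pow (h b) 6)).comp hA
  convert this using 2 with v
  rw [omega_pow_six]
  funext i
  have hI := Complex.I_mul_I
  by_cases h1 : i = a
  · subst h1
    simp only [twoLevel, oneLevel, Matrix.smul_apply, smul_eq_mul, ne_eq, hab, not_false_eq_true,
      Function.update_of_ne, Function.update_self]
    linear_combination (A 0 0 * v i + A 0 1 * v b) * hI
  · by_cases h2 : i = b
    · subst h2
      simp only [twoLevel, oneLevel, Matrix.smul_apply, smul_eq_mul, ne_eq, h1, not_false_eq_true,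
        Function.update_of_ne, Function.update_self]
      linear_combination (A 1 0 * v a + A 1 1 * v i) * hI
    · simp [twoLevel, oneLevel, h1, h2]

lemma twoLevel_gateX {ι : Type*} [DecidableEq ι] (a b : ι) (v : ι → ℂ) :
    twoLevel a b gateX v = v ∘ Equiv.swap a b := by
  funext i
  simp only [twoLevel, gateX, Function.comp_apply, Function.update_apply, Equiv.swap_apply_def]
  by_cases h1 : i = a <;> by_cases h2 : i = b
  · subst h1; subst h2; simp
  · subst h1; simp [h2]
  · subst h2; simp [h1]
  · simp [h1, h2]

lemma realizes_swap_trans {ι : Type*} [Fintype ι] [DecidableEq ι]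
    {G : Subgroup (Matrix.unitaryGroup ι ℂ)} {a b c : ι}
    (hab : Realizes G (fun v => v ∘ Equiv.swap a b))
    (hbc : Realizes G (fun v => v ∘ Equiv.swap b c)) :
    Realizes G (fun v => v ∘ Equiv.swap a c) := by
  by_cases h1 : a = b
  · subst h1; exact hbc
  by_cases h2 : a = c
  · subst h2
    convert Realizes.id G using 2
    simp
  rw [Equiv.swap_comm a c, ← Equiv.swap_mul_swap_mul_swap h1 h2]
  exact (hbc.comp hab).comp hbc

lemma realizes_perm {ι : Type*} [Fintype ι] [DecidableEq ι]
    {G : Subgroup (Matrix.unitaryGroup ι ℂ)}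
    (h : ∀ a b, Realizes G (fun v => v ∘ Equiv.swap a b)) (σ : Equiv.Perm ι) :
    Realizes G (fun v => v ∘ σ) := by
  induction σ using Equiv.Perm.swap_induction_on with
  | one => exact Realizes.id G
  | swap_mul σ a b _ ih => exact ih.comp (h a b)

lemma exists_perm_apply_eq {ι : Type*} [DecidableEq ι] {a b c d : ι} (hab : a ≠ b) (hcd : c ≠ d) :
    ∃ σ : Equiv.Perm ι, σ a = c ∧ σ b = d := by
  refine ⟨Equiv.swap (Equiv.swap a c b) d * Equiv.swap a c, ?_, ?_⟩
  · rw [Equiv.Perm.mul_apply, Equiv.swap_apply_left, Equiv.swap_apply_of_ne_of_ne _ hcd]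
    intro e
    apply hab
    have : Equiv.swap a c a = Equiv.swap a c b := by rw [← e, Equiv.swap_apply_left]
    exact (Equiv.swap a c).injective this
  · rw [Equiv.Perm.mul_apply, Equiv.swap_apply_left]

/-- Conjugation by a permutation carries one pair of coordinates to any other, so a two-level gate
is needed for one pair only. -/
lemma realizes_twoLevel_transport {ι : Type*} [Fintype ι] [DecidableEq ι]
    {G : Subgroup (Matrix.unitaryGroup ι ℂ)}
    (h : ∀ σ : Equiv.Perm ι, Realizes G (fun v => v ∘ σ)) {a b c d : ι} (hab : a ≠ b)
    (hcd : c ≠ d) {A : Matrix (Fin 2) (Fin 2) ℂ} (hA : Realizes G (twoLevel a b A)) :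
    Realizes G (twoLevel c d A) := by
  obtain ⟨σ, hσ1, hσ2⟩ := exists_perm_apply_eq hcd hab
  convert ((h σ).comp hA).comp (h σ⁻¹) using 2 with v
  funext i
  have h1 : σ i = a ↔ i = c := by rw [← hσ1, σ.injective.eq_iff]
  have h2 : σ i = b ↔ i = d := by rw [← hσ2, σ.injective.eq_iff]
  have h3 : σ⁻¹ a = c := by rw [← hσ1]; simp
  have h4 : σ⁻¹ b = d := by rw [← hσ2]; simp
  simp only [twoLevel, Function.comp_apply, Function.update_apply, h1, h2, h3, h4]
  simp

lemma ne_update_one {n : ℕ} {i : Fin n} {a : Bits n} (ha : a i = 0) :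
    a ≠ Function.update a i 1 := by
  intro e
  have := congrFun e i
  simp [ha] at this

lemma oneAncilla_adjacent_swap {n : ℕ} (i : Fin n) (a : Bits n) (ha : a i = 0) :
    Realizes (oneAncillaGroup n) (fun v => v ∘ Equiv.swap a (Function.update a i 1)) := by
  have hI : gateIX = Complex.I • gateX := by
    rw [gateIX, gateX]
    simp
  have h := realizes_ctrl i a ha (isCircuit_ctrl_gateIX _ (by simp) (Fin.append a 0))
  rw [hI] at h
  simpa only [twoLevel_gateX] using
    (funext (twoLevel_gateX a (Function.update a i 1))) ▸
      realizes_neg_I_smul realizes_oneLevel (ne_update_one ha) h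

lemma oneAncilla_swap {n : ℕ} (a b : Bits n) :
    Realizes (oneAncillaGroup n) (fun v => v ∘ Equiv.swap a b) := by
  -- Walk from `a` to `b` in the hypercube, flipping one bit at a time; each edge of the walk is an
  -- adjacent transposition.
  have key : ∀ s : Finset (Fin n),
      Realizes (oneAncillaGroup n) (fun v => v ∘ Equiv.swap a (s.piecewise b a)) := by
    intro s
    induction s using Finset.induction_on with
    | empty =>
      convert Realizes.id (oneAncillaGroup n) using 2
      simp
    | insert c s hc ih =>
      rw [Finset.piecewise_insert]
      refine realizes_swap_trans ih ?_
      generalize s.piecewise b a = x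
      generalize b c = d
      have hx : x c = 0 ∨ x c = 1 := by omega
      have hd : d = 0 ∨ d = 1 := by omega
      by_cases hxd : x c = d
      · rw [← hxd, Function.update_eq_self]
        convert Realizes.id (oneAncillaGroup n) using 2
        simp
      rcases hx with hx | hx
      · have : d = 1 := by omega
        subst this
        exact oneAncilla_adjacent_swap c x hx
      · have : d = 0 := by omega
        subst this
        have h := oneAncilla_adjacent_swap c (Function.update x c 0) (by simp)
        rw [Function.update_idem, ← hx, Function.update_eq_self, Equiv.swap_comm] at h
        exact h
  simpa using key Finset.univ

lemma oneAncilla_gateH {n : ℕ} {a b : Bits n} (hab : a ≠ b) :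
    Realizes (oneAncillaGroup n) (twoLevel a b gateH) := by
  -- Only the existence of a qubit is used: H is built for the zero string and its neighbour along
  -- `i`, then transported.
  obtain ⟨i, -⟩ := Function.ne_iff.1 hab
  have h0 : (0 : Bits n) i = 0 := rfl
  exact realizes_twoLevel_transport (realizes_perm oneAncilla_swap) (ne_update_one h0) hab
    (realizes_neg_I_smul realizes_oneLevel (ne_update_one h0)
      (realizes_ctrl i 0 h0 (isCircuit_ctrl_gateIH _ (by simp) (Fin.append 0 0))))

/-! ### Entries of circuits -/

lemma inv_sqrt_two_mem : (1 : ℂ) / (Real.sqrt 2 : ℂ) ∈ entryRing :=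
  Subring.subset_closure (by simp)

lemma I_mem : Complex.I ∈ entryRing := Subring.subset_closure (by simp)

lemma omega_mem : omega ∈ entryRing := by
  rw [omega_eq]
  exact mul_mem inv_sqrt_two_mem (add_mem (one_mem _) I_mem)

lemma star_mem_entryRing {z : ℂ} (hz : z ∈ entryRing) : star z ∈ entryRing := by
  induction hz using Subring.closure_induction with
  | mem x hx =>
    rcases hx with rfl | rfl
    · have : star ((1 : ℂ) / (Real.sqrt 2 : ℂ)) = 1 / (Real.sqrt 2 : ℂ) := by simp
      rw [this]; exact inv_sqrt_two_mem
    · have : star Complex.I = -Complex.I := by simp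
      rw [this]; exact neg_mem I_mem
  | zero => simp
  | one => simp
  | add x y _ _ hx hy => rw [star_add]; exact add_mem hx hy
  | neg x _ hx => rw [star_neg]; exact neg_mem hx
  | mul x y _ _ hx hy => rw [star_mul']; exact mul_mem hx hy

lemma onQubit_entry_mem {N : ℕ} (q : Fin N) {A : Matrix (Fin 2) (Fin 2) ℂ}
    (hA : ∀ i j, A i j ∈ entryRing) (x y : Bits N) : onQubit q A x y ∈ entryRing := by
  simp only [onQubit, Matrix.of_apply]
  split_ifs
  · exact hA _ _
  · exact zero_mem _

lemma entry_mem_of_isGate {N : ℕ} {A : Op N} (hA : IsGate N A) (x y : Bits N) :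
    A x y ∈ entryRing := by
  have h0 := zero_mem entryRing
  have h1 := one_mem entryRing
  cases hA with
  | omega =>
    rw [Matrix.smul_apply, Matrix.one_apply, smul_eq_mul]
    split_ifs
    · exact mul_mem omega_mem h1
    · exact mul_mem omega_mem h0
  | H q =>
    refine onQubit_entry_mem q (fun i j => ?_) x y
    have h := inv_sqrt_two_mem
    rw [gateH_eq]
    fin_cases i <;> fin_cases j
    exacts [h, h, h, neg_mem h]
  | S q =>
    refine onQubit_entry_mem q (fun i j => ?_) x y
    fin_cases i <;> fin_cases j
    exacts [h1, h0, h0, I_mem]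
  | T q =>
    refine onQubit_entry_mem q (fun i j => ?_) x y
    fin_cases i <;> fin_cases j
    exacts [h1, h0, h0, omega_mem]
  | CNOT c t h =>
    simp only [cnot, Matrix.of_apply]
    split_ifs
    · exact h1
    · exact h0

lemma entry_mem_of_mem_cliffordTGroup {N : ℕ} {V : Matrix.unitaryGroup (Bits N) ℂ}
    (hV : V ∈ cliffordTGroup N) : ∀ x y, (V : Op N) x y ∈ entryRing := by
  induction hV using Subgroup.closure_induction with
  | mem V hV => exact entry_mem_of_isGate hV
  | one =>
    intro x y
    rw [Matrix.UnitaryGroup.one_apply, Matrix.one_apply]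
    split_ifs
    · exact one_mem _
    · exact zero_mem _
  | mul V W _ _ hV hW =>
    intro x y
    rw [Matrix.UnitaryGroup.mul_apply, Matrix.mul_apply]
    exact sum_mem fun z _ => mul_mem (hV _ _) (hW _ _)
  | inv V _ hV =>
    intro x y
    rw [Matrix.UnitaryGroup.inv_apply, Matrix.star_apply]
    exact star_mem_entryRing (hV _ _)

lemma entry_mem_of_representable {n m : ℕ} {U : Op n} (h : RepresentableWithAncillas m U)
    (x y : Bits n) : U x y ∈ entryRing := by
  obtain ⟨V, hV, h⟩ := h
  rw [eq_of_represented h]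
  exact entry_mem_of_mem_cliffordTGroup hV _ _

/-! ### The ring `ℤ[ω]` and its prime element `1 - ω` -/

/-- The element `a + b ω + c ω² + d ω³` of `ℤ[ω]`. -/
noncomputable def cyclo (a b c d : ℤ) : ℂ := a + b * omega + c * omega ^ 2 + d * omega ^ 3

lemma cyclo_mul (a b c d a' b' c' d' : ℤ) :
    cyclo a b c d * cyclo a' b' c' d' = cyclo (a * a' - b * d' - c * c' - d * b')
      (a * b' + b * a' - c * d' - d * c') (a * c' + b * b' + c * a' - d * d')
      (a * d' + b * c' + c * b' + d * a') := by
  have h := omega_pow_four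
  unfold cyclo
  push_cast
  linear_combination ((b * d' + c * c' + d * b' : ℂ) + (c * d' + d * c' : ℂ) * omega
    + (d * d' : ℂ) * omega ^ 2) * h

/-- The ring `ℤ[ω]`. -/
noncomputable def zOmega : Subring ℂ where
  carrier := {z | ∃ a b c d, z = cyclo a b c d}
  zero_mem' := ⟨0, 0, 0, 0, by simp [cyclo]⟩
  one_mem' := ⟨1, 0, 0, 0, by simp [cyclo]⟩
  add_mem' := by
    rintro _ _ ⟨a, b, c, d, rfl⟩ ⟨a', b', c', d', rfl⟩
    refine ⟨a + a', b + b', c + c', d + d', ?_⟩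
    unfold cyclo; push_cast; ring
  neg_mem' := by
    rintro _ ⟨a, b, c, d, rfl⟩
    refine ⟨-a, -b, -c, -d, ?_⟩
    unfold cyclo; push_cast; ring
  mul_mem' := by
    rintro _ _ ⟨a, b, c, d, rfl⟩ ⟨a', b', c', d', rfl⟩
    exact ⟨_, _, _, _, cyclo_mul _ _ _ _ _ _ _ _⟩

lemma cyclo_mem (a b c d : ℤ) : cyclo a b c d ∈ zOmega := ⟨a, b, c, d, rfl⟩

lemma omega_mem_zOmega : omega ∈ zOmega := ⟨0, 1, 0, 0, by simp [cyclo]⟩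

lemma one_sub_omega_mem : 1 - omega ∈ zOmega := sub_mem (one_mem _) omega_mem_zOmega

lemma star_mul_self_one_sub_omega :
    star (1 - omega) * (1 - omega) = 2 - (Real.sqrt 2 : ℂ) := by
  rw [star_sub, star_one, star_omega, sqrt_two_eq]
  linear_combination (omega ^ 4 - 1 - omega ^ 3) * omega_pow_four

lemma one_sub_omega_ne_zero : 1 - omega ≠ 0 := by
  intro h
  have h1 : omega = 1 := by linear_combination -h
  have h2 := omega_pow_four
  rw [h1] at h2
  norm_num at h2

/-- Divisibility by `1 - ω` in `ℤ[ω]`. -/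
def PiDvd (z : ℂ) : Prop := ∃ r ∈ zOmega, z = (1 - omega) * r

lemma PiDvd.mem {z : ℂ} (h : PiDvd z) : z ∈ zOmega := by
  obtain ⟨r, hr, rfl⟩ := h
  exact mul_mem one_sub_omega_mem hr

lemma PiDvd.mul_left {z w : ℂ} (h : PiDvd z) (hw : w ∈ zOmega) : PiDvd (w * z) := by
  obtain ⟨r, hr, rfl⟩ := h
  exact ⟨w * r, mul_mem hw hr, by ring⟩

/-- Modulo 1 - ω every power of ω is 1, and 2 is 0. The explicit quotient solves A + D = a, B - A =
b, C - B = c, D - C = d, for which an even coefficient sum is exactly what is needed. -/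
lemma piDvd_cyclo {a b c d : ℤ} (h : Even (a + b + c + d)) : PiDvd (cyclo a b c d) := by
  obtain ⟨s, hs⟩ := h
  refine ⟨cyclo (a - s) (a + b - s) (a + b + c - s) s, cyclo_mem _ _ _ _, ?_⟩
  have hd : d = s + s - a - b - c := by omega
  subst hd
  have h4 := omega_pow_four
  unfold cyclo
  push_cast
  linear_combination s * h4

/-- The coefficients are chosen so that linear independence of the powers of ω is never needed: a
multiple of 1 - ω is expanded from its quotient, which makes the sum even, and otherwise any
expansion works by `piDvd_cyclo`. -/
lemma exists_cyclo_even {z : ℂ} (hz : z ∈ zOmega) :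
    ∃ a b c d : ℤ, z = cyclo a b c d ∧ (Even (a + b + c + d) ↔ PiDvd z) := by
  by_cases h : PiDvd z
  · obtain ⟨_, ⟨a, b, c, d, rfl⟩, rfl⟩ := id h
    refine ⟨a + d, b - a, c - b, d - c, ?_, ?_⟩
    · have h4 := omega_pow_four
      unfold cyclo
      push_cast
      linear_combination -d * h4
    · simp only [h, iff_true]
      exact ⟨d, by ring⟩
  · obtain ⟨a, b, c, d, rfl⟩ := hz
    refine ⟨a, b, c, d, rfl, ?_⟩
    simp only [h, iff_false]
    exact fun he => h (piDvd_cyclo he)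

lemma one_sub_omega_sq_div_sqrt_two :
    (1 - omega) ^ 2 * (1 / (Real.sqrt 2 : ℂ)) = cyclo (-1) 1 (-1) 0 := by
  have h0 := sqrt_two_ne_zero
  field_simp
  rw [sqrt_two_eq]
  have h4 := omega_pow_four
  unfold cyclo
  push_cast
  linear_combination (1 - omega) * h4

lemma exists_pow_mul_mem {z : ℂ} (hz : z ∈ entryRing) : ∃ e : ℕ, (1 - omega) ^ e * z ∈ zOmega := by
  induction hz using Subring.closure_induction with
  | mem x hx =>
    rcases hx with rfl | rfl
    · exact ⟨2, by rw [one_sub_omega_sq_div_sqrt_two]; exact cyclo_mem _ _ _ _⟩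
    · exact ⟨0, 0, 0, 1, 0, by simp [cyclo, omega_sq]⟩
  | zero => exact ⟨0, by simp [zero_mem]⟩
  | one => exact ⟨0, by simp [one_mem]⟩
  | add x y _ _ hx hy =>
    obtain ⟨e, he⟩ := hx
    obtain ⟨f, hf⟩ := hy
    refine ⟨e + f, ?_⟩
    have : (1 - omega) ^ (e + f) * (x + y)
        = (1 - omega) ^ f * ((1 - omega) ^ e * x) + (1 - omega) ^ e * ((1 - omega) ^ f * y) := by
      ring
    rw [this]
    exact add_mem (mul_mem (pow_mem one_sub_omega_mem _) he)
      (mul_mem (pow_mem one_sub_omega_mem _) hf)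
  | neg x _ hx =>
    obtain ⟨e, he⟩ := hx
    exact ⟨e, by rw [mul_neg]; exact neg_mem he⟩
  | mul x y _ _ hx hy =>
    obtain ⟨e, he⟩ := hx
    obtain ⟨f, hf⟩ := hy
    refine ⟨e + f, ?_⟩
    have : (1 - omega) ^ (e + f) * (x * y)
        = ((1 - omega) ^ e * x) * ((1 - omega) ^ f * y) := by ring
    rw [this]
    exact mul_mem he hf

lemma exists_common_pow_mul_mem {ι : Type*} [Fintype ι] {v : ι → ℂ} (hv : ∀ i, v i ∈ entryRing) :
    ∃ e : ℕ, ∀ i, (1 - omega) ^ e * v i ∈ zOmega := by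
  choose e he using fun i => exists_pow_mul_mem (hv i)
  refine ⟨Finset.univ.sup e, fun i => ?_⟩
  obtain ⟨k, hk⟩ := Nat.exists_eq_add_of_le (Finset.le_sup (f := e) (Finset.mem_univ i))
  rw [hk, pow_add, mul_right_comm]
  exact mul_mem (he i) (pow_mem one_sub_omega_mem _)

lemma star_mul_self_cyclo (a b c d : ℤ) : star (cyclo a b c d) * cyclo a b c d
    = ((a ^ 2 + b ^ 2 + c ^ 2 + d ^ 2 : ℤ) : ℂ)
      + ((a * b + b * c + c * d - d * a : ℤ) : ℂ) * (Real.sqrt 2 : ℂ) := by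
  have h7 : star omega = -omega ^ 3 := by
    rw [star_omega, show omega ^ 7 = omega ^ 4 * omega ^ 3 by ring, omega_pow_four]; ring
  have h4 := omega_pow_four
  have hs : star (cyclo a b c d) = cyclo a (-d) (-c) (-b) := by
    unfold cyclo
    simp only [star_add, star_mul', star_pow, star_intCast, h7]
    push_cast
    linear_combination (c * omega ^ 2 - d * omega ^ 5 + d * omega) * h4
  rw [hs, cyclo_mul, sqrt_two_eq]
  unfold cyclo
  push_cast
  ring

lemma int_add_int_mul_sqrt_two_inj {a b a' b' : ℤ}
    (h : (a : ℂ) + b * (Real.sqrt 2 : ℂ) = a' + b' * (Real.sqrt 2 : ℂ)) : a = a' := by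
  have h1 : (a : ℝ) + b * Real.sqrt 2 = a' + b' * Real.sqrt 2 := by exact_mod_cast h
  by_cases hb : b = b'
  · subst hb
    have : (a : ℝ) = a' := by linarith
    exact_mod_cast this
  · exfalso
    have hb' : ((b - b' : ℤ) : ℝ) ≠ 0 := by
      exact_mod_cast sub_ne_zero.2 hb
    apply irrational_sqrt_two.ne_rat (((a' - a : ℤ) : ℚ) / ((b - b' : ℤ) : ℚ))
    rw [Rat.cast_div, Rat.cast_intCast, Rat.cast_intCast, eq_div_iff hb']
    push_cast
    linarith

/-- The exponent has to be positive: the zeroth power is 1, whose rational part is odd. -/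
lemma exists_two_sub_sqrt_two_pow (e : ℕ) :
    ∃ c d : ℤ, (2 - (Real.sqrt 2 : ℂ)) ^ (e + 1)
      = ((2 * c : ℤ) : ℂ) + (d : ℂ) * (Real.sqrt 2 : ℂ) := by
  induction e with
  | zero => exact ⟨1, -1, by push_cast; ring⟩
  | succ e ih =>
    obtain ⟨c, d, h⟩ := ih
    refine ⟨2 * c - d, 2 * d - 2 * c, ?_⟩
    rw [pow_succ, h]
    push_cast
    linear_combination -(d : ℂ) * sqrt_two_sq

/-- All coefficients have the same parity. If they are even, the quotient is still a multiple of √2;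
if they are odd, the number is 1 + ω + ω² + ω³ = 2/(1 - ω) plus an even one, and it contains (1 -
ω)³ while √2 removes only (1 - ω)². -/
lemma piDvd_cyclo_div_sqrt_two {a b c d : ℤ} (hb : Even (a + b)) (hc : Even (b + c))
    (hd : Even (c + d)) : PiDvd (cyclo a b c d / (Real.sqrt 2 : ℂ)) := by
  obtain ⟨p, hp⟩ := hb
  obtain ⟨q, hq⟩ := hc
  obtain ⟨r, hr⟩ := hd
  obtain rfl : b = p + p - a := by omega
  obtain rfl : c = q + q - p - p + a := by omega
  obtain rfl : d = r + r - q - q + p + p - a := by omega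
  have : cyclo a (p + p - a) (q + q - p - p + a) (r + r - q - q + p + p - a) / (Real.sqrt 2 : ℂ)
      = cyclo (q - r) (a + q - p) (2 * p - a - q + r) (q - p) := by
    rw [div_eq_iff sqrt_two_ne_zero, sqrt_two_eq]
    have h4 := omega_pow_four
    unfold cyclo
    push_cast
    linear_combination ((a + q - p : ℂ) + (2 * p - a - q + r) * omega
      + (q - p) * omega ^ 2 - (q - p : ℂ)) * h4
  rw [this]
  exact piDvd_cyclo ⟨q, by ring⟩

/-- The coefficient sum is odd, so one or three coefficients are odd and exactly one differs in
parity from the other three. Multiplication by ω rotates the coefficients up to sign, which brings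
the exceptional one to the front. -/
lemma exists_omega_pow_mul_cyclo {z : ℂ} (hz : z ∈ zOmega) (h : ¬ PiDvd z) :
    ∃ (k : ℕ) (a b c d : ℤ), z = omega ^ k * cyclo a b c d ∧ Odd (a + b) ∧ Even (b + c)
      ∧ Even (c + d) := by
  obtain ⟨a, b, c, d, rfl⟩ := hz
  have ho : Odd (a + b + c + d) := by
    rw [← Int.not_even_iff_odd]
    exact fun he => h (piDvd_cyclo he)
  have h4 := omega_pow_four
  have key : (Odd (a + b) ∧ Even (b + c) ∧ Even (c + d)) ∨
      (Odd (b + c) ∧ Even (c + d) ∧ Even (d + -a)) ∨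
      (Odd (c + d) ∧ Even (d + -a) ∧ Even (-a + -b)) ∨
      (Odd (d + -a) ∧ Even (-a + -b) ∧ Even (-b + -c)) := by
    simp only [Int.odd_iff, Int.even_iff] at *
    omega
  rcases key with h | h | h | h
  · exact ⟨0, a, b, c, d, by simp, h⟩
  · refine ⟨1, b, c, d, -a, ?_, h⟩
    unfold cyclo; push_cast
    linear_combination a * h4
  · refine ⟨2, c, d, -a, -b, ?_, h⟩
    unfold cyclo; push_cast
    linear_combination (a + b * omega) * h4
  · refine ⟨3, d, -a, -b, -c, ?_, h⟩
    unfold cyclo; push_cast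
    linear_combination (a + b * omega + c * omega ^ 2) * h4

lemma exists_piDvd_add_sub {x y : ℂ} (hx : x ∈ zOmega) (hx' : ¬ PiDvd x) (hy : y ∈ zOmega)
    (hy' : ¬ PiDvd y) :
    ∃ m : ℕ, PiDvd ((x + omega ^ m * y) / (Real.sqrt 2 : ℂ)) ∧
      PiDvd ((x - omega ^ m * y) / (Real.sqrt 2 : ℂ)) := by
  obtain ⟨k, a, b, c, d, rfl, h1, h2, h3⟩ := exists_omega_pow_mul_cyclo hx hx'
  obtain ⟨l, a', b', c', d', rfl, h1', h2', h3'⟩ := exists_omega_pow_mul_cyclo hy hy'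
  have hl : ∀ z : ℂ, omega ^ (k + 7 * l) * (omega ^ l * z) = omega ^ k * z := by
    intro z
    -- The exponent 7l plays the role of -l, as ω⁸ = 1.
    have : omega ^ (k + 7 * l) * (omega ^ l * z) = omega ^ k * (omega ^ 8) ^ l * z := by ring
    rw [this, omega_pow_eight, one_pow, mul_one]
  refine ⟨k + 7 * l, ?_, ?_⟩
  · have : (omega ^ k * cyclo a b c d + omega ^ (k + 7 * l) * (omega ^ l * cyclo a' b' c' d'))
        / (Real.sqrt 2 : ℂ)
        = omega ^ k * (cyclo (a + a') (b + b') (c + c') (d + d') / (Real.sqrt 2 : ℂ)) := by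
      rw [hl]; unfold cyclo; push_cast; ring
    rw [this]
    refine (piDvd_cyclo_div_sqrt_two ?_ ?_ ?_).mul_left (pow_mem omega_mem_zOmega k)
    all_goals
      simp only [Int.odd_iff, Int.even_iff] at *
      omega
  · have : (omega ^ k * cyclo a b c d - omega ^ (k + 7 * l) * (omega ^ l * cyclo a' b' c' d'))
        / (Real.sqrt 2 : ℂ)
        = omega ^ k * (cyclo (a - a') (b - b') (c - c') (d - d') / (Real.sqrt 2 : ℂ)) := by
      rw [hl]; unfold cyclo; push_cast; ring
    rw [this]
    refine (piDvd_cyclo_div_sqrt_two ?_ ?_ ?_).mul_left (pow_mem omega_mem_zOmega k)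
    all_goals
      simp only [Int.odd_iff, Int.even_iff] at *
      omega

lemma exists_eq_omega_pow {a b c d : ℤ} (h : a ^ 2 + b ^ 2 + c ^ 2 + d ^ 2 = 1) :
    ∃ m : ℕ, omega ^ m * cyclo a b c d = 1 := by
  have ha : -1 ≤ a ∧ a ≤ 1 := by constructor <;> nlinarith [sq_nonneg b, sq_nonneg c, sq_nonneg d]
  have hb : -1 ≤ b ∧ b ≤ 1 := by constructor <;> nlinarith [sq_nonneg a, sq_nonneg c, sq_nonneg d]
  have hc : -1 ≤ c ∧ c ≤ 1 := by constructor <;> nlinarith [sq_nonneg b, sq_nonneg a, sq_nonneg d]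
  have hd : -1 ≤ d ∧ d ≤ 1 := by constructor <;> nlinarith [sq_nonneg b, sq_nonneg c, sq_nonneg a]
  have key : ∀ x : ℤ, -1 ≤ x ∧ x ≤ 1 → x = 0 ∨ ((x = 1 ∨ x = -1) ∧ x ^ 2 = 1) := by
    rintro x ⟨h1, h2⟩
    interval_cases x <;> simp
  have h4 := omega_pow_four
  rcases key a ha with rfl | ⟨ha, ha'⟩
  · rcases key b hb with rfl | ⟨hb, hb'⟩
    · rcases key c hc with rfl | ⟨hc, hc'⟩
      · rcases key d hd with rfl | ⟨rfl | rfl, -⟩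
        · norm_num at h
        · exact ⟨5, by unfold cyclo; push_cast; linear_combination (omega ^ 4 - 1) * h4⟩
        · exact ⟨1, by unfold cyclo; push_cast; linear_combination -h4⟩
      · have hd0 : d = 0 := by nlinarith
        subst hd0
        rcases hc with rfl | rfl
        · exact ⟨6, by unfold cyclo; push_cast; linear_combination (omega ^ 4 - 1) * h4⟩
        · exact ⟨2, by unfold cyclo; push_cast; linear_combination -h4⟩
    · have hc0 : c = 0 := by nlinarith [sq_nonneg d]
      have hd0 : d = 0 := by nlinarith [sq_nonneg c]
      subst hc0 hd0
      rcases hb with rfl | rfl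
      · exact ⟨7, by unfold cyclo; push_cast; linear_combination (omega ^ 4 - 1) * h4⟩
      · exact ⟨3, by unfold cyclo; push_cast; linear_combination -h4⟩
  · have hb0 : b = 0 := by nlinarith [sq_nonneg d, sq_nonneg c]
    have hc0 : c = 0 := by nlinarith [sq_nonneg d, sq_nonneg b]
    have hd0 : d = 0 := by nlinarith [sq_nonneg c, sq_nonneg b]
    subst hb0 hc0 hd0
    rcases ha with rfl | rfl
    · exact ⟨0, by unfold cyclo; push_cast; ring⟩
    · exact ⟨4, by unfold cyclo; push_cast; linear_combination -h4⟩

/-! ### Reduction of columns -/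

lemma sum_sq_of_star_dot {ι : Type*} [Fintype ι] {v : ι → ℂ} {a b c d : ι → ℤ} {x y : ℤ}
    (hv : ∀ i, v i = cyclo (a i) (b i) (c i) (d i))
    (h : dotProduct (star v) v = (x : ℂ) + y * (Real.sqrt 2 : ℂ)) :
    ∑ i, (a i ^ 2 + b i ^ 2 + c i ^ 2 + d i ^ 2) = x := by
  apply int_add_int_mul_sqrt_two_inj (b := ∑ i, (a i * b i + b i * c i + c i * d i - d i * a i))
    (b' := y)
  rw [← h, dotProduct, Int.cast_sum, Int.cast_sum, Finset.sum_mul, ← Finset.sum_add_distrib]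
  refine Finset.sum_congr rfl fun i _ => ?_
  rw [Pi.star_apply, hv, star_mul_self_cyclo]

lemma twoLevel_gateH {ι : Type*} [DecidableEq ι] (j l : ι) (v : ι → ℂ) : twoLevel j l gateH v
    = Function.update (Function.update v j ((v j + v l) / (Real.sqrt 2 : ℂ))) l
      ((v j - v l) / (Real.sqrt 2 : ℂ)) := by
  simp only [twoLevel, gateH_eq, Matrix.of_apply, Matrix.cons_val', Matrix.cons_val_zero,
    Matrix.cons_val_one, Matrix.cons_val_fin_one]
  congr 1
  · congr 1; ring
  · ring

section

variable {ι : Type*} [Fintype ι] [DecidableEq ι] {G : Subgroup (Matrix.unitaryGroup ι ℂ)}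

/-- An element of `G` maps `v` to a standard basis vector, and fixes the basis vectors outside the
support of `v`. -/
def Reducible (G : Subgroup (Matrix.unitaryGroup ι ℂ)) (v : ι → ℂ) : Prop :=
  ∃ g ∈ G, (∃ j, v j ≠ 0 ∧ (g : Matrix ι ι ℂ).mulVec v = Pi.single j 1) ∧
    ∀ i, v i = 0 → (g : Matrix ι ι ℂ).mulVec (Pi.single i 1) = Pi.single i 1

lemma Reducible.of_realizes {f : (ι → ℂ) → ι → ℂ} (hf : Realizes G f) {v : ι → ℂ}
    (h1 : ∀ i, v i = 0 → f (Pi.single i 1) = Pi.single i 1) (h2 : ∀ i, v i = 0 → f v i = 0)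
    (h : Reducible G (f v)) : Reducible G v := by
  obtain ⟨g, hg, hgf⟩ := hf
  obtain ⟨g', hg', ⟨j, hj, hj'⟩, h'⟩ := h
  have hmul : ∀ w, ((g' * g : Matrix.unitaryGroup ι ℂ) : Matrix ι ι ℂ).mulVec w
      = (g' : Matrix ι ι ℂ).mulVec (f w) := by
    intro w
    rw [← hgf, Matrix.mulVec_mulVec]
    rfl
  refine ⟨g' * g, mul_mem hg' hg, ⟨j, fun e => hj (h2 j e), ?_⟩, fun i hi => ?_⟩
  · rw [hmul, hj']
  · rw [hmul, h1 i hi, h' i (h2 i hi)]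

lemma unitary_mulVec_star_dot (g : Matrix.unitaryGroup ι ℂ) (v w : ι → ℂ) :
    dotProduct (star ((g : Matrix ι ι ℂ).mulVec v)) ((g : Matrix ι ι ℂ).mulVec w)
      = dotProduct (star v) w := by
  rw [mulVec_star_dot, Matrix.mem_unitaryGroup_iff'.1 g.2, Matrix.one_mulVec]

lemma Realizes.star_dot {f : (ι → ℂ) → ι → ℂ} (hf : Realizes G f) (v : ι → ℂ) :
    dotProduct (star (f v)) (f v) = dotProduct (star v) v := by
  obtain ⟨g, -, h⟩ := hf
  rw [← h, unitary_mulVec_star_dot]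

lemma reducible_of_integral (hω : ∀ a, Realizes G (oneLevel a omega)) {v : ι → ℂ}
    (hnorm : dotProduct (star v) v = 1) (hv : ∀ i, v i ∈ zOmega) : Reducible G v := by
  choose a b c d habcd using hv
  have hsum := sum_sq_of_star_dot (x := 1) (y := 0) habcd (by simpa using hnorm)
  have hnn : ∀ i, 0 ≤ a i ^ 2 + b i ^ 2 + c i ^ 2 + d i ^ 2 := fun i => by positivity
  obtain ⟨j, -, hj⟩ : ∃ j ∈ Finset.univ, a j ^ 2 + b j ^ 2 + c j ^ 2 + d j ^ 2 ≠ 0 := by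
    apply Finset.exists_ne_zero_of_sum_ne_zero
    rw [hsum]; norm_num
  have hj1 := hnn j
  rw [← Finset.add_sum_erase _ _ (Finset.mem_univ j)] at hsum
  have hrest : 0 ≤ ∑ i ∈ Finset.univ.erase j, (a i ^ 2 + b i ^ 2 + c i ^ 2 + d i ^ 2) :=
    Finset.sum_nonneg fun i _ => hnn i
  -- Nonnegative integers with sum 1: one entry takes all of it and the others vanish.
  have hjone : a j ^ 2 + b j ^ 2 + c j ^ 2 + d j ^ 2 = 1 := by omega
  have hzero : ∀ i, i ≠ j → v i = 0 := by
    intro i hi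
    have h0 := (Finset.sum_eq_zero_iff_of_nonneg fun i _ => hnn i).1
      (show ∑ i ∈ Finset.univ.erase j, (a i ^ 2 + b i ^ 2 + c i ^ 2 + d i ^ 2) = 0 by omega) i
      (by simp [hi])
    have ha : a i = 0 := by nlinarith [sq_nonneg (b i), sq_nonneg (c i), sq_nonneg (d i)]
    have hb : b i = 0 := by nlinarith [sq_nonneg (a i), sq_nonneg (c i), sq_nonneg (d i)]
    have hc : c i = 0 := by nlinarith [sq_nonneg (b i), sq_nonneg (a i), sq_nonneg (d i)]
    have hd : d i = 0 := by nlinarith [sq_nonneg (b i), sq_nonneg (c i), sq_nonneg (a i)]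
    rw [habcd, ha, hb, hc, hd]
    simp [cyclo]
  obtain ⟨m, hm⟩ := exists_eq_omega_pow hjone
  rw [← habcd] at hm
  obtain ⟨g, hg, hgf⟩ := realizes_oneLevel_pow (hω j) m
  refine ⟨g, hg, ⟨j, fun e => by simp [e] at hm, ?_⟩, fun i hi => ?_⟩
  · rw [hgf, oneLevel, hm]
    funext i
    by_cases hi : i = j
    · subst hi; simp
    · simp [hi, hzero i hi]
  · have hij : j ≠ i := by
      rintro rfl
      simp [hi] at hm
    rw [hgf, oneLevel]
    simp [hij]

lemma exists_pair_not_piDvd {v : ι → ℂ} {e : ℕ} (hnorm : dotProduct (star v) v = 1)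
    (hv : ∀ i, (1 - omega) ^ (e + 1) * v i ∈ zOmega) {j : ι}
    (hj : ¬ PiDvd ((1 - omega) ^ (e + 1) * v j)) :
    ∃ l, j ≠ l ∧ ¬ PiDvd ((1 - omega) ^ (e + 1) * v l) := by
  by_contra! hcon
  choose a b c d habcd heven using fun i => exists_cyclo_even (hv i)
  obtain ⟨x, y, hxy⟩ := exists_two_sub_sqrt_two_pow e
  have hsum := sum_sq_of_star_dot (v := fun i => (1 - omega) ^ (e + 1) * v i) (x := 2 * x)
    (y := y) habcd (by
      rw [← hxy, ← star_mul_self_one_sub_omega, mul_pow,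
        show (fun i => (1 - omega) ^ (e + 1) * v i) = (1 - omega) ^ (e + 1) • v from rfl,
        star_smul, smul_dotProduct, dotProduct_smul, hnorm, star_pow]
      simp)
  have hpar : ∀ i, Even (a i ^ 2 + b i ^ 2 + c i ^ 2 + d i ^ 2) ↔
      PiDvd ((1 - omega) ^ (e + 1) * v i) := by
    intro i
    rw [← heven]
    -- Squaring does not change parity, so the sum of squares and the coefficient sum have the same
    -- parity.
    simp [Int.even_add, Int.even_pow]
  rw [← Finset.add_sum_erase _ _ (Finset.mem_univ j)] at hsum
  have hrest : Even (∑ i ∈ Finset.univ.erase j, (a i ^ 2 + b i ^ 2 + c i ^ 2 + d i ^ 2)) := by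
    refine Finset.even_sum _ fun i hi => (hpar i).2 (hcon i ?_)
    exact (Finset.ne_of_mem_erase hi).symm
  refine hj ((hpar j).1 ?_)
  rw [Int.even_iff] at hrest ⊢
  omega

/-- Lexicographic induction on the exponent `e` and the number `k` of scaled entries not divisible
by 1 - ω. -/
lemma reducible_of_pow_mul_mem (hω : ∀ a, Realizes G (oneLevel a omega))
    (hH : ∀ a b, a ≠ b → Realizes G (twoLevel a b gateH)) (e k : ℕ) (v : ι → ℂ)
    (hnorm : dotProduct (star v) v = 1) (hv : ∀ i, (1 - omega) ^ e * v i ∈ zOmega)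
    (hk : {i | ¬ PiDvd ((1 - omega) ^ e * v i)}.ncard = k) : Reducible G v := by
  induction e generalizing k v with
  | zero => exact reducible_of_integral hω hnorm (by simpa using hv)
  | succ e ihe =>
    induction k using Nat.strong_induction_on generalizing v with
    | _ k ih =>
    by_cases hex : ∃ j, ¬ PiDvd ((1 - omega) ^ (e + 1) * v j)
    swap
    -- All entries are divisible: cancel one factor 1 - ω and lower the exponent.
    · push Not at hex
      refine ihe _ v hnorm (fun i => ?_) rfl
      obtain ⟨r, hr, h⟩ := hex i
      rw [pow_succ', mul_assoc] at h
      rwa [mul_left_cancel₀ one_sub_omega_ne_zero h]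
    obtain ⟨j, hj⟩ := hex
    obtain ⟨l, hjl, hl⟩ := exists_pair_not_piDvd hnorm hv hj
    obtain ⟨m, hm1, hm2⟩ := exists_piDvd_add_sub (hv j) hj (hv l) hl
    have hf := (hH j l hjl).comp (realizes_oneLevel_pow (hω l) m)
    simp only [twoLevel_gateH, oneLevel, Function.update_self, Function.update_of_ne hjl] at hf
    have hzero : ∀ {i}, v i = 0 → i ≠ j ∧ i ≠ l := by
      intro i hi
      constructor
      · rintro rfl; exact hj ⟨0, zero_mem _, by simp [hi]⟩
      · rintro rfl; exact hl ⟨0, zero_mem _, by simp [hi]⟩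
    set f : (ι → ℂ) → ι → ℂ := fun v => Function.update (Function.update (Function.update v l
      (omega ^ m * v l)) j ((v j + omega ^ m * v l) / (Real.sqrt 2 : ℂ))) l
        ((v j - omega ^ m * v l) / (Real.sqrt 2 : ℂ)) with hfdef
    have hfj : f v j = (v j + omega ^ m * v l) / (Real.sqrt 2 : ℂ) := by simp [hfdef, hjl]
    have hfl : f v l = (v j - omega ^ m * v l) / (Real.sqrt 2 : ℂ) := by simp [hfdef]
    have hfi : ∀ i, i ≠ j → i ≠ l → f v i = v i := fun i h1 h2 => by simp [hfdef, h1, h2]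
    have hdj : PiDvd ((1 - omega) ^ (e + 1) * f v j) := by
      rw [hfj]; convert hm1 using 1; ring
    have hdl : PiDvd ((1 - omega) ^ (e + 1) * f v l) := by
      rw [hfl]; convert hm2 using 1; ring
    refine Reducible.of_realizes hf (fun i hi => ?_) (fun i hi => ?_) (ih _ ?_ (f v) ?_ ?_ rfl)
    · obtain ⟨h1, h2⟩ := hzero hi
      funext i'
      simp only [hfdef, Function.update_apply, Pi.single_apply]
      split_ifs <;> simp_all
    · obtain ⟨h1, h2⟩ := hzero hi
      rw [hfi i h1 h2, hi]
    -- Coordinates `j` and `l` leave the set of non-divisible entries, and no coordinate enters it.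
    · rw [← hk]
      refine Set.ncard_lt_ncard ?_ (Set.toFinite _)
      refine ⟨fun i hi => ?_, fun hsub => hsub hj hdj⟩
      have h1 : i ≠ j := by rintro rfl; exact hi hdj
      have h2 : i ≠ l := by rintro rfl; exact hi hdl
      change ¬ PiDvd ((1 - omega) ^ (e + 1) * f v i) at hi
      rwa [hfi i h1 h2] at hi
    · rw [hf.star_dot, hnorm]
    · intro i
      by_cases h1 : i = j
      · rw [h1]; exact hdj.mem
      by_cases h2 : i = l
      · rw [h2]; exact hdl.mem
      rw [hfi i h1 h2]
      exact hv i

/-- Exact synthesis: unitary matrices with entries in `ℤ[1/√2, i]` are products of one-level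
phases, transpositions and two-level Hadamard matrices. -/
lemma mem_of_entries_mem (hG : ∀ g ∈ G, ∀ x y, (g : Matrix ι ι ℂ) x y ∈ entryRing)
    (hω : ∀ a, Realizes G (oneLevel a omega))
    (hswap : ∀ a b, Realizes G (fun v => v ∘ Equiv.swap a b))
    (hH : ∀ a b, a ≠ b → Realizes G (twoLevel a b gateH))
    (U : Matrix.unitaryGroup ι ℂ) (hU : ∀ x y, (U : Matrix ι ι ℂ) x y ∈ entryRing) : U ∈ G := by
  have key : ∀ s : Finset ι, ∃ g ∈ G, ∀ i ∈ s,
      ((g * U : Matrix.unitaryGroup ι ℂ) : Matrix ι ι ℂ).mulVec (Pi.single i 1)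
        = Pi.single i 1 := by
    intro s
    induction s using Finset.induction_on with
    | empty => exact ⟨1, one_mem G, by simp⟩
    | insert c s hc ih =>
      obtain ⟨g, hg, h⟩ := ih
      set M := g * U with hM
      set v := (M : Matrix ι ι ℂ).mulVec (Pi.single c 1) with hv
      have hnorm : dotProduct (star v) v = 1 := by
        rw [hv, unitary_mulVec_star_dot, ← Pi.single_star]
        simp
      have hmem : ∀ i, v i ∈ entryRing := by
        intro i
        have : v i = (M : Matrix ι ι ℂ) i c := by simp [hv]
        rw [this, hM, Matrix.UnitaryGroup.mul_apply, Matrix.mul_apply]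
        exact sum_mem fun z _ => mul_mem (hG g hg _ _) (hU _ _)
      -- Column `c` is orthogonal to the finished columns, which are basis vectors.
      have hzero : ∀ i ∈ s, v i = 0 := by
        intro i hi
        have hic : c ≠ i := fun e => hc (e ▸ hi)
        have h1 := unitary_mulVec_star_dot M (Pi.single i 1) (Pi.single c 1)
        rw [h i hi, ← hv, ← Pi.single_star] at h1
        simpa [hic] using h1
      obtain ⟨e, he⟩ := exists_common_pow_mul_mem hmem
      obtain ⟨g', hg', ⟨j, hj, hj'⟩, hfix⟩ := reducible_of_pow_mul_mem hω hH e _ v hnorm he rfl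
      -- The entry of `v` at `j` is nonzero, so `j` is not a finished index, and moving it to `c`
      -- disturbs no finished column.
      obtain ⟨t, ht, hts⟩ := hswap j c
      have hmul : ∀ w, ((t * g' * g * U : Matrix.unitaryGroup ι ℂ) : Matrix ι ι ℂ).mulVec w
          = (g' : Matrix ι ι ℂ).mulVec ((M : Matrix ι ι ℂ).mulVec w) ∘ Equiv.swap j c := by
        intro w
        refine Eq.trans ?_ (hts _)
        rw [Matrix.mulVec_mulVec, Matrix.mulVec_mulVec, hM, mul_assoc, mul_assoc, mul_assoc]
        rfl
      refine ⟨t * g' * g, mul_mem (mul_mem ht hg') hg, fun i hi => ?_⟩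
      rw [hmul]
      rcases Finset.mem_insert.1 hi with rfl | hi
      · rw [← hv, hj']
        funext x
        rw [Function.comp_apply, Pi.single_apply, Pi.single_apply]
        congr 1
        rw [Equiv.swap_apply_eq_iff, Equiv.swap_apply_left]
      · rw [h i hi, hfix i (hzero i hi)]
        have hij : i ≠ j := by rintro rfl; exact hj (hzero i hi)
        have hic : i ≠ c := fun e => hc (e ▸ hi)
        funext x
        rw [Function.comp_apply, Pi.single_apply, Pi.single_apply]
        congr 1
        rw [Equiv.swap_apply_eq_iff, Equiv.swap_apply_of_ne_of_ne hij hic]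
  obtain ⟨g, hg, h⟩ := key Finset.univ
  have h1 : g * U = 1 := by
    ext x y
    have := congrFun (h y (Finset.mem_univ y)) x
    rw [Matrix.UnitaryGroup.one_apply, Matrix.one_apply, ← Pi.single_apply]
    simpa using this
  rw [eq_inv_of_mul_eq_one_right h1]
  exact inv_mem hg

end

lemma representable_of_entries_mem {n : ℕ} {U : Op n} (hU : U ∈ Matrix.unitaryGroup (Bits n) ℂ)
    (h : ∀ x y, U x y ∈ entryRing) : RepresentableWithAncillas 1 U :=
  mem_of_entries_mem (G := oneAncillaGroup n)
    (fun _ hg => entry_mem_of_representable (m := 1) hg) realizes_oneLevel oneAncilla_swap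
    (fun _ _ => oneAncilla_gateH) ⟨U, hU⟩ h

end CliffordT

theorem theorem1 (n : ℕ) (U : CliffordT.Op n)
    (hU : U ∈ Matrix.unitaryGroup (CliffordT.Bits n) ℂ) :
    ((∃ m : ℕ, CliffordT.RepresentableWithAncillas m U) ↔
        ∀ x y, U x y ∈ CliffordT.entryRing) ∧
      ((∃ m : ℕ, CliffordT.RepresentableWithAncillas m U) →
        CliffordT.RepresentableWithAncillas 1 U) := by
  have h : (∃ m : ℕ, CliffordT.RepresentableWithAncillas m U) →
      ∀ x y, U x y ∈ CliffordT.entryRing :=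
    fun ⟨_, hm⟩ => CliffordT.entry_mem_of_representable hm
  exact ⟨⟨h, fun hm => ⟨1, CliffordT.representable_of_entries_mem hU hm⟩⟩,
    fun hm => CliffordT.representable_of_entries_mem hU (h hm)⟩
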